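/- Work over $\mathbb C$ and fix an integer $d\ge 0$. Let $S_m$ be the space of homogeneous polynomials of degree $m$ in $z_0,z_1,z_2$ ($S_{-1}=0$). A vector field of degree $d$ on $\mathbb P^2$ is an element $\mathcal X=\sum F_i\,\partial/\partial z_i$ ($F_i\in S_d$) of $V_d^2=H^0(\mathbb P^2,T\mathbb P^2(d-1))=S_d^{\oplus 3}/S_{d-1}R$, where $R=\sum z_i\,\partial/\partial z_i$ is the radial field; the space of foliations of degree $d$ is $\mathbb P^N=\mathbb P(V_d^2)$, the space of lines in $V_d^2$. Let $\mathbb P^5=\mathbb P(S_2)$ be the space of conics, $U\subset\mathbb P^5$ the open set of smooth conics, and $\mathbb V\subset\mathbb P^5$ the Veronese surface of double lines. For a conic $G$ let $\widetilde{\mathcal M}_G\subset V_d^2$ be the kernel of the linear map $V_d^2\to S_{d+1}/G\,S_{d-1}$ induced by $\mathcal X\mapsto \mathcal X(G)=\sum F_i\,\partial G/\partial z_i$; for smooth $G$ it is the space of vector fields that leave the conic $G=0$ invariant. An irreducible curve $Z\subset\mathbb P^2$ is invariant by $\mathcal X$ if $\mathcal X(p)\in T_pZ$ for all $p\in Z$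 that are singular neither for $Z$ nor for $\mathcal X$. Let $\mathbb Y\subset\mathbb P^N$ be the Zariski closure of the set of foliations that have an invariant smooth conic. **Theorem.** Let $\pi:\mathbb B\to\mathbb P^5$ be the blowup of $\mathbb P^5$ along $\mathbb V$ (the variety of complete conics). There is an algebraic vector subbundle $\mathcal E$ of the trivial bundle $\mathbb B\times V_d^2$ such that $\mathcal E_b=\widetilde{\mathcal M}_{\pi(b)}$ for every $b\in\pi^{-1}(U)$, and the image of $\mathbb P(\mathcal E)\subset\mathbb B\times\mathbb P^N$ under the projection to $\mathbb P^N$ is equal to $\mathbb Y$. -/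

import Mathlib

open MvPolynomial
open scoped LinearAlgebra.Projectivization

noncomputable section

/-! ### Projective varieties over `ℂ`

Varieties are treated classically, through their closed points. -/

section Zariski

variable {W W₁ W₂ V : Type*} [AddCommGroup W] [Module ℂ W] [AddCommGroup W₁] [Module ℂ W₁]
  [AddCommGroup W₂] [Module ℂ W₂] [AddCommGroup V] [Module ℂ V]

/-- The algebra of polynomial functions on a (finite dimensional) complex vector space `W`: the
algebra of functions generated by the linear forms. -/
def polyFun (W : Type*) [AddCommGroup W] [Module ℂ W] : Subalgebra ℂ (W → ℂ) :=
  Algebra.adjoin ℂ (Set.range fun φ : Module.Dual ℂ W => (φ : W → ℂ))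

/-- `f` is homogeneous of degree `m`. -/
def IsForm (m : ℕ) (f : W → ℂ) : Prop :=
  ∀ (c : ℂ) (w : W), f (c • w) = c ^ m * f w

/-- The map `f` on `W₁ × W₂` is bihomogeneous of bidegree `(m, k)`. -/
def IsBiform (m k : ℕ) (f : W₁ × W₂ → V) : Prop :=
  ∀ (s t : ℂ) (w₁ : W₁) (w₂ : W₂), f (s • w₁, t • w₂) = (s ^ m * t ^ k) • f (w₁, w₂)

/-- Zariski closed subsets of the projective space `ℙ(W)` of lines in `W`: the common zero loci
of sets of homogeneous polynomials. -/
def IsZariskiClosed (Z : Set (ℙ ℂ W)) : Prop :=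
  ∃ T : Set (W → ℂ), (∀ f ∈ T, f ∈ polyFun W ∧ ∃ m, IsForm m f) ∧
    Z = {p | ∀ f ∈ T, f p.rep = 0}

/-- Zariski closure in `ℙ(W)`. -/
def zariskiClosure (S : Set (ℙ ℂ W)) : Set (ℙ ℂ W) :=
  ⋂₀ {Z | IsZariskiClosed Z ∧ S ⊆ Z}

/-- Homogeneous coordinates of a point of `ℙ(W₁) × ℙ(W₂)`. -/
def coords (x : ℙ ℂ W₁ × ℙ ℂ W₂) : W₁ × W₂ := (x.1.rep, x.2.rep)

/-- Zariski closed subsets of the variety `ℙ(W₁) × ℙ(W₂)`: the common zero loci of sets of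
bihomogeneous polynomials. -/
def IsBiZariskiClosed (Z : Set (ℙ ℂ W₁ × ℙ ℂ W₂)) : Prop :=
  ∃ T : Set (W₁ × W₂ → ℂ), (∀ f ∈ T, f ∈ polyFun (W₁ × W₂) ∧ ∃ m k, IsBiform m k f) ∧
    Z = {x | ∀ f ∈ T, f (coords x) = 0}

/-- Zariski closure in the variety `ℙ(W₁) × ℙ(W₂)`. -/
def biZariskiClosure (S : Set (ℙ ℂ W₁ × ℙ ℂ W₂)) : Set (ℙ ℂ W₁ × ℙ ℂ W₂) :=
  ⋂₀ {Z | IsBiZariskiClosed Z ∧ S ⊆ Z}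

/-- A map `s : X → V` from a subvariety `X` of `ℙ(W₁) × ℙ(W₂)` to a vector space is regular at
`x₀` if on a Zariski open neighbourhood of `x₀` it is a quotient `P / Q`, where `P` (with values
in `V`) and `Q` are bihomogeneous polynomials of the same bidegree and `Q` has no zero. -/
def IsRegularAt (X : Set (ℙ ℂ W₁ × ℙ ℂ W₂)) (s : X → V) (x₀ : X) : Prop :=
  ∃ U : Set (ℙ ℂ W₁ × ℙ ℂ W₂), IsBiZariskiClosed Uᶜ ∧ (x₀ : ℙ ℂ W₁ × ℙ ℂ W₂) ∈ U ∧
    ∃ (m k : ℕ) (P : W₁ × W₂ → V) (Q : W₁ × W₂ → ℂ),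
      (∀ φ : Module.Dual ℂ V, (fun w => φ (P w)) ∈ polyFun (W₁ × W₂)) ∧ IsBiform m k P ∧
      Q ∈ polyFun (W₁ × W₂) ∧ IsBiform m k Q ∧
      ∀ x : X, (x : ℙ ℂ W₁ × ℙ ℂ W₂) ∈ U →
        Q (coords x.1) ≠ 0 ∧ s x = (Q (coords x.1))⁻¹ • P (coords x.1)

/-- A family `E` of linear subspaces of `V`, parametrized by the subvariety `X` of
`ℙ(W₁) × ℙ(W₂)`, is an (algebraic) vector subbundle of rank `r` of the trivial bundle `X × V`:
locally in the Zariski topology there are `r` regular sections of `X × V`, linearly independent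
at every point, that form a basis of the fibres of `E`. -/
def IsSubbundle (X : Set (ℙ ℂ W₁ × ℙ ℂ W₂)) (r : ℕ) (E : X → Submodule ℂ V) : Prop :=
  ∀ x₀ : X, ∃ U : Set (ℙ ℂ W₁ × ℙ ℂ W₂),
    IsBiZariskiClosed Uᶜ ∧ (x₀ : ℙ ℂ W₁ × ℙ ℂ W₂) ∈ U ∧
    ∃ s : Fin r → X → V, ∀ x : X, (x : ℙ ℂ W₁ × ℙ ℂ W₂) ∈ U →
      (∀ i, IsRegularAt X (s i) x) ∧
      LinearIndependent ℂ (fun i => s i x) ∧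
      Submodule.span ℂ (Set.range fun i => s i x) = E x

/-- The projective bundle `ℙ(E) ⊆ X × ℙ(V)` of a family of subspaces of `V`. -/
def projBundle (X : Set (ℙ ℂ W₁ × ℙ ℂ W₂)) (E : X → Submodule ℂ V) : Set (X × ℙ ℂ V) :=
  {y | y.2.submodule ≤ E y.1}

/-- The ideal of the polynomial functions on `W` that vanish on (the cone over) `Z`. -/
def vanishingIdl (Z : Set (ℙ ℂ W)) : Ideal (polyFun W) where
  carrier := {f | ∀ p ∈ Z, ∀ w ∈ p.submodule, f.1 w = 0}
  add_mem' := by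
    intro a b ha hb p hp w hw
    simp [ha p hp w hw, hb p hp w hw]
  zero_mem' := by
    intro p _ w _
    simp
  smul_mem' := by
    intro c a ha p hp w hw
    simp [ha p hp w hw]

/-- A system of homogeneous polynomials of the same degree that generate the ideal of `Z`. -/
structure GeneratingForms (Z : Set (ℙ ℂ W)) (ι : Type*) where
  degree : ℕ
  form : ι → polyFun W
  isForm : ∀ i, IsForm degree (form i).1
  span_eq : Ideal.span (Set.range form) = vanishingIdl Z

/-- The blowup of `ℙ(W)` along the closed subvariety `Z`, built from a system `f` of generators
of the same degree of the ideal of `Z` (the result does not depend on `f` up to isomorphism over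
`ℙ(W)`): the closure in `ℙ(W) × ℙ(ℂ^ι)` of the graph of the morphism `p ↦ (fᵢ(p))ᵢ` on the
complement of `Z`. The blowup map is the first projection. -/
def blowup (Z : Set (ℙ ℂ W)) {ι : Type*} (f : GeneratingForms Z ι) :
    Set (ℙ ℂ W × ℙ ℂ (ι → ℂ)) :=
  biZariskiClosure {x | x.1 ∉ Z ∧ (fun i => (f.form i).1 x.1.rep) ∈ x.2.submodule}

end Zariski

/-! ### Vector fields of degree `d` on the projective plane -/

/-- The space of ternary forms of degree `d`. -/
abbrev TForm (d : ℕ) : Submodule ℂ (MvPolynomial (Fin 3) ℂ) := homogeneousSubmodule (Fin 3) ℂ d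

/-- The multiples `H R` of the radial field `R = ∑ zᵢ ∂ᵢ` among the fields `∑ Fᵢ ∂ᵢ` with `Fᵢ`
homogeneous of degree `d`. (The factor `H` is automatically homogeneous of degree `d - 1`, and
zero if `d = 0`.) -/
def radial (d : ℕ) : Submodule ℂ (Fin 3 → TForm d) where
  carrier := {F | ∃ H : MvPolynomial (Fin 3) ℂ, ∀ i, (F i : MvPolynomial (Fin 3) ℂ) = H * X i}
  add_mem' := by
    rintro a b ⟨H, hH⟩ ⟨K, hK⟩
    exact ⟨H + K, fun i => by simp [hH i, hK i, add_mul]⟩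
  zero_mem' := ⟨0, fun i => by simp⟩
  smul_mem' := by
    rintro c a ⟨H, hH⟩
    exact ⟨c • H, fun i => by simp [hH i]⟩

/-- The space of vector fields of degree `d` on the plane, i.e. of global sections of
`Tℙ²(d - 1)`, presented by the Euler sequence. -/
abbrev VField (d : ℕ) : Type := (Fin 3 → TForm d) ⧸ radial d

/-- The derivation `θ_G : 𝒳 = ∑ Fᵢ ∂ᵢ ↦ 𝒳(G) = ∑ Fᵢ ∂ᵢG` for a quadratic form `G`. -/
def theta (d : ℕ) (G : TForm 2) : (Fin 3 → TForm d) →ₗ[ℂ] TForm (d + 1) where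
  toFun F := ⟨∑ i, (F i : MvPolynomial (Fin 3) ℂ) * pderiv i (G : MvPolynomial (Fin 3) ℂ), by
    refine Submodule.sum_mem _ fun i _ => ?_
    have h1 : (F i : MvPolynomial (Fin 3) ℂ).IsHomogeneous d := (F i).2
    have h2 : (G : MvPolynomial (Fin 3) ℂ).IsHomogeneous 2 := G.2
    exact h1.mul h2.pderiv⟩
  map_add' F F' := by
    ext1
    simp [add_mul, Finset.sum_add_distrib]
  map_smul' c F := by
    ext1
    simp [Finset.smul_sum]

/-- The forms of degree `d + 1` that are multiples of the quadratic form `G`. -/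
def conicMultiples (d : ℕ) (G : TForm 2) : Submodule ℂ (TForm (d + 1)) where
  carrier := {F | (G : MvPolynomial (Fin 3) ℂ) ∣ F}
  add_mem' := fun ha hb => dvd_add ha hb
  zero_mem' := dvd_zero _
  smul_mem' := fun c _ h => by
    rw [Set.mem_ofPred_eq, Submodule.coe_smul, MvPolynomial.smul_eq_C_mul]
    exact Dvd.dvd.mul_left h _

theorem radial_le_comap_theta (d : ℕ) (G : TForm 2) :
    radial d ≤ (conicMultiples d G).comap (theta d G) := by
  rintro F ⟨H, hH⟩
  refine ⟨2 * H, ?_⟩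
  have h2 : (G : MvPolynomial (Fin 3) ℂ).IsHomogeneous 2 := G.2
  have h := h2.sum_X_mul_pderiv
  simp only [theta, LinearMap.coe_mk, AddHom.coe_mk, hH]
  simp only [mul_assoc, ← Finset.mul_sum, h]
  rw [nsmul_eq_mul]
  push_cast
  ring

/-- The map induced by `θ_G` from vector fields of degree `d` to `S_{d+1} / G S_{d-1}`. -/
def thetaBar (d : ℕ) (G : TForm 2) :
    VField d →ₗ[ℂ] (TForm (d + 1) ⧸ conicMultiples d G) :=
  Submodule.mapQ (radial d) (conicMultiples d G) (theta d G) (radial_le_comap_theta d G)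

/-- The space of vector fields of degree `d` that leave the conic `G = 0` invariant,
as the kernel of the map induced by `θ_G`. -/
def invariantFields (d : ℕ) (G : TForm 2) : Submodule ℂ (VField d) := LinearMap.ker (thetaBar d G)

/-- The conic `G = 0` is smooth. -/
def SmoothConic (G : TForm 2) : Prop :=
  ∀ p : Fin 3 → ℂ, p ≠ 0 → eval p (G : MvPolynomial (Fin 3) ℂ) = 0 →
    ∃ i, eval p (pderiv i (G : MvPolynomial (Fin 3) ℂ)) ≠ 0

/-- The irreducible conic `Z : G = 0` is invariant by `𝒳 = ∑ Fᵢ ∂ᵢ`: at every point `p` of `Z`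
that is singular neither for `Z` nor for `𝒳`, the vector `𝒳(p)` is tangent to `Z`. -/
def IsInvariantConic {d : ℕ} (F : Fin 3 → TForm d) (G : TForm 2) : Prop :=
  ∀ p : Fin 3 → ℂ, p ≠ 0 → eval p (G : MvPolynomial (Fin 3) ℂ) = 0 →
    (∃ i, eval p (pderiv i (G : MvPolynomial (Fin 3) ℂ)) ≠ 0) →
    (¬ ∃ c : ℂ, ∀ i, eval p (F i : MvPolynomial (Fin 3) ℂ) = c * p i) →
    ∑ i, eval p (F i : MvPolynomial (Fin 3) ℂ) *
      eval p (pderiv i (G : MvPolynomial (Fin 3) ℂ)) = 0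

/-- The locus in `ℙᴺ = ℙ(V_d)` of the foliations of degree `d` on the plane that have an
invariant smooth conic. -/
def smoothConicLocus (d : ℕ) : Set (ℙ ℂ (VField d)) :=
  {ξ | ∃ (F : Fin 3 → TForm d) (G : TForm 2), (radial d).mkQ F = ξ.rep ∧
    SmoothConic G ∧ IsInvariantConic F G}

/-! ### Complete conics -/

/-- The Veronese surface of double lines in the projective space `ℙ⁵` of conics. -/
def veronese : Set (ℙ ℂ (TForm 2)) :=
  {p | ∃ l ∈ TForm 1, (p.rep : MvPolynomial (Fin 3) ℂ) = l ^ 2}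

/-- The `(i, j)` entry of the symmetric matrix of a quadratic form, as a linear form. -/
def entryForm (i j : Fin 3) : Module.Dual ℂ (TForm 2) :=
  (2⁻¹ : ℂ) • ((lcoeff ℂ 0).comp
    (((pderiv i).toLinearMap.comp (pderiv j).toLinearMap).comp (TForm 2).subtype))

/-- The universal symmetric matrix: its value at `G` is the symmetric matrix of `G`. -/
def univMatrix : Matrix (Fin 3) (Fin 3) (polyFun (TForm 2)) :=
  Matrix.of fun i j => ⟨entryForm i j, Algebra.subset_adjoin ⟨entryForm i j, rfl⟩⟩

theorem entryForm_apply (i j : Fin 3) (G : TForm 2) :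
    entryForm i j G = 2⁻¹ * constantCoeff (pderiv i (pderiv j (G : MvPolynomial (Fin 3) ℂ))) :=
  rfl

theorem entryForm_symm (i j : Fin 3) : entryForm i j = entryForm j i := by
  ext G
  have h : ⁅(pderiv i : Derivation ℂ (MvPolynomial (Fin 3) ℂ) _), pderiv j⁆ = (0 : Derivation ℂ (MvPolynomial (Fin 3) ℂ) _) := by
    apply MvPolynomial.derivation_ext
    intro k
    simp [Derivation.commutator_apply, pderiv_X, Pi.single_apply, apply_ite]
  have h' := congrArg (fun D : Derivation ℂ (MvPolynomial (Fin 3) ℂ) _ => D G.1) h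
  simp only [Derivation.commutator_apply, Derivation.coe_zero, Pi.zero_apply, sub_eq_zero] at h'
  rw [entryForm_apply, entryForm_apply, h']

theorem entryForm_sq (i j : Fin 3) (G : TForm 2) (l : MvPolynomial (Fin 3) ℂ) (hl : l ∈ TForm 1)
    (h : (G : MvPolynomial (Fin 3) ℂ) = l ^ 2) :
    entryForm i j G = constantCoeff (pderiv i l) * constantCoeff (pderiv j l) := by
  have h0 : constantCoeff l = 0 := by
    have hl' : l.IsHomogeneous 1 := hl
    rw [constantCoeff_eq]
    by_contra hne
    simpa using hl' hne
  rw [entryForm_apply, h, pow_two]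
  simp only [Derivation.leibniz, smul_eq_mul, map_add, map_mul, h0]
  ring

theorem linForm_mem (v : Fin 3 → ℂ) : (∑ i, C (v i) * X i : MvPolynomial (Fin 3) ℂ) ∈ TForm 1 := by
  refine Submodule.sum_mem _ fun i _ => ?_
  exact (isHomogeneous_X ℂ i).C_mul (v i)

theorem entry_expansion (G : TForm 2) :
    (G : MvPolynomial (Fin 3) ℂ) = ∑ i, ∑ j, entryForm i j G • (X i * X j) := by
  have h2 : (G : MvPolynomial (Fin 3) ℂ).IsHomogeneous 2 := G.2
  have h := h2.sum_X_mul_pderiv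
  have h1 : ∀ j, ∑ i, X i * pderiv i (pderiv j (G : MvPolynomial (Fin 3) ℂ)) =
      pderiv j (G : MvPolynomial (Fin 3) ℂ) := by
    intro j
    have := (h2.pderiv (i := j)).sum_X_mul_pderiv
    simpa using this
  have h0 : ∀ i j, pderiv i (pderiv j (G : MvPolynomial (Fin 3) ℂ)) =
      C (2 * entryForm i j G) := by
    intro i j
    have : (pderiv i (pderiv j (G : MvPolynomial (Fin 3) ℂ))).IsHomogeneous 0 :=
      (h2.pderiv (i := j)).pderiv (i := i)
    rw [entryForm_apply, mul_inv_cancel_left₀ two_ne_zero]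
    exact (totalDegree_eq_zero_iff_eq_C.1 ((totalDegree_zero_iff_isHomogeneous _).2 this))
  have h3 : (2 : MvPolynomial (Fin 3) ℂ) * G =
      2 * ∑ i, ∑ j, entryForm i j G • (X i * X j) := by
    have h' := h
    simp only [nsmul_eq_mul, Nat.cast_ofNat] at h'
    rw [← h', Finset.sum_comm, Finset.mul_sum]
    refine Finset.sum_congr rfl fun j _ => ?_
    rw [← h1 j, Finset.mul_sum, Finset.mul_sum]
    refine Finset.sum_congr rfl fun i _ => ?_
    rw [h0, smul_eq_C_mul, map_mul]
    simp only [map_ofNat]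
    ring
  exact mul_left_cancel₀ two_ne_zero h3

/-- The ideal generated by the `2 × 2` minors of the universal symmetric matrix. -/
def minorIdl : Ideal (polyFun (TForm 2)) :=
  Ideal.span (Set.range fun ij : Fin 3 × Fin 3 => univMatrix.adjugate ij.1 ij.2)

theorem univMatrix_symm (i j : Fin 3) : univMatrix i j = univMatrix j i := by
  apply Subtype.ext
  show (entryForm i j : TForm 2 → ℂ) = entryForm j i
  rw [entryForm_symm]

set_option maxHeartbeats 2000000 in
theorem symm_rank_one {R : Type*} [CommRing R] (u : Fin 3 → Fin 3 → R)
    (hu : ∀ i j, u i j = u j i) (h : ∀ i j, (Matrix.of u).adjugate i j = 0) (p q r s : Fin 3) :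
    u p q * u r s = u p r * u q s := by
  rw [Matrix.adjugate_fin_three] at h
  have k00 := h 0 0
  have k01 := h 0 1
  have k02 := h 0 2
  have k11 := h 1 1
  have k12 := h 1 2
  have k22 := h 2 2
  have e10 := hu 1 0
  have e20 := hu 2 0
  have e21 := hu 2 1
  simp only [Matrix.of_apply, Matrix.cons_val, e10, e20, e21] at k00 k01 k02 k11 k12 k22
  have c : ∀ i : Fin 3, i = 0 ∨ i = 1 ∨ i = 2 := by decide
  clear h hu
  rcases c p with rfl | rfl | rfl <;> rcases c q with rfl | rfl | rfl <;>
    rcases c r with rfl | rfl | rfl <;> rcases c s with rfl | rfl | rfl <;>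
    (try simp only [e10, e20, e21]) <;>
    first
    | ring1
    | linear_combination k00
    | linear_combination k01
    | linear_combination k02
    | linear_combination k11
    | linear_combination k12
    | linear_combination k22
    | linear_combination -k00
    | linear_combination -k01
    | linear_combination -k02
    | linear_combination -k11
    | linear_combination -k12
    | linear_combination -k22

/-- The class of an entry of the universal matrix modulo the minors. -/
def entryClass (i j : Fin 3) : polyFun (TForm 2) ⧸ minorIdl := Ideal.Quotient.mk _ (univMatrix i j)

theorem entryClass_symm (i j : Fin 3) : entryClass i j = entryClass j i := by
  rw [entryClass, entryClass, univMatrix_symm]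

theorem entryClass_exch (p q r s : Fin 3) :
    entryClass p q * entryClass r s = entryClass p r * entryClass q s := by
  refine symm_rank_one entryClass entryClass_symm (fun i j => ?_) p q r s
  have h : (Matrix.of entryClass) = (Ideal.Quotient.mk minorIdl).mapMatrix univMatrix := rfl
  rw [h, ← RingHom.map_adjugate, RingHom.mapMatrix_apply, Matrix.map_apply]
  exact Ideal.Quotient.eq_zero_iff_mem.2 (Ideal.subset_span ⟨(i, j), rfl⟩)

/-- The product of the classes of the entries indexed by consecutive pairs in a list. -/
def pairProd : List (Fin 3) → polyFun (TForm 2) ⧸ minorIdl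
  | [] => 1
  | [_] => 0
  | x :: y :: l => entryClass x y * pairProd l

theorem pairProd_perm {l l' : List (Fin 3)} (h : l.Perm l') :
    pairProd l = pairProd l' ∧ ∀ x, pairProd (x :: l) = pairProd (x :: l') := by
  induction h with
  | nil => exact ⟨rfl, fun _ => rfl⟩
  | cons a _ ih => exact ⟨ih.2 a, fun x => by rw [pairProd, pairProd, ih.1]⟩
  | swap x y l =>
    refine ⟨by rw [pairProd, pairProd, entryClass_symm], fun z => ?_⟩
    cases l with
    | nil => simp [pairProd]
    | cons w l =>
      simp only [pairProd, ← mul_assoc]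
      rw [entryClass_exch z y x w]
  | trans _ _ ih ih' => exact ⟨ih.1.trans ih'.1, fun x => (ih.2 x).trans (ih'.2 x)⟩

/-- `pairProd` on multisets. -/
def pairProdM (s : Multiset (Fin 3)) : polyFun (TForm 2) ⧸ minorIdl :=
  Quot.liftOn s pairProd fun _ _ h => (pairProd_perm h).1

theorem pairProdM_cons (p q : Fin 3) (s : Multiset (Fin 3)) :
    pairProdM (p ::ₘ q ::ₘ s) = entryClass p q * pairProdM s := by
  induction s using Quot.inductionOn
  rfl

/-- The linear extension of `pairProdM` to ternary polynomials. -/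
def pairMap : MvPolynomial (Fin 3) ℂ →ₗ[ℂ] polyFun (TForm 2) ⧸ minorIdl :=
  (basisMonomials (Fin 3) ℂ).constr ℂ fun u => pairProdM (Finsupp.toMultiset u)

theorem pairMap_monomial (u : Fin 3 →₀ ℕ) :
    pairMap (monomial u 1) = pairProdM (Finsupp.toMultiset u) := by
  have h := (basisMonomials (Fin 3) ℂ).constr_basis ℂ
    (fun u => pairProdM (Finsupp.toMultiset u)) u
  rwa [coe_basisMonomials] at h

theorem pairMap_mul (p q : Fin 3) (g : MvPolynomial (Fin 3) ℂ) :
    pairMap (g * (X p * X q)) = entryClass p q * pairMap g := by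
  induction g using MvPolynomial.induction_on' with
  | monomial u a =>
    have h1 : monomial u a * (X p * X q) =
        a • (monomial (Finsupp.single p 1 + (Finsupp.single q 1 + u)) (1 : ℂ)) := by
      rw [X, X, monomial_mul, monomial_mul, smul_monomial]
      congr 1
      · abel_nf
      · simp
    have h2 : monomial u a = a • (monomial u (1 : ℂ)) := by simp [smul_monomial]
    rw [h1, h2, map_smul, map_smul, pairMap_monomial, pairMap_monomial, map_add, map_add,
      Finsupp.toMultiset_single, Finsupp.toMultiset_single, one_smul, one_smul,
      Multiset.singleton_add, Multiset.singleton_add, pairProdM_cons, mul_smul_comm]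
  | add a b ha hb => rw [add_mul, map_add, map_add, ha, hb, mul_add]

/-- The evaluation of polynomials in nine variables at the entries of the universal matrix. -/
def entryEval : MvPolynomial (Fin 3 × Fin 3) ℂ →ₐ[ℂ] polyFun (TForm 2) :=
  aeval fun ij => univMatrix ij.1 ij.2

theorem entryEval_surjective : Function.Surjective entryEval := by
  have h : ∀ f (hf : f ∈ polyFun (TForm 2)), (⟨f, hf⟩ : polyFun (TForm 2)) ∈ entryEval.range := by
    intro f hf
    induction hf using Algebra.adjoin_induction with
    | mem x hx =>
      obtain ⟨φ, rfl⟩ := hx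
      have hX : ∀ i j : Fin 3, (X i * X j : MvPolynomial (Fin 3) ℂ) ∈ TForm 2 := fun i j =>
        (isHomogeneous_X ℂ i).mul (isHomogeneous_X ℂ j)
      refine ⟨∑ i, ∑ j, C (φ ⟨_, hX i j⟩) * X (i, j), ?_⟩
      apply Subtype.ext
      funext G
      have hG : G = ∑ i, ∑ j, entryForm i j G • (⟨_, hX i j⟩ : TForm 2) := by
        apply Subtype.ext
        simp only [AddSubmonoidClass.coe_finsetSum, SetLike.val_smul]
        exact entry_expansion G
      have hφ : φ G = ∑ i, ∑ j, entryForm i j G * φ ⟨_, hX i j⟩ := by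
        conv_lhs => rw [hG]
        simp only [map_sum, map_smul, smul_eq_mul]
      simp only [entryEval, AlgHom.toRingHom_eq_coe, RingHom.coe_coe, map_sum, map_mul, algHom_C,
        aeval_X, AddSubmonoidClass.coe_finsetSum, Finset.sum_apply]
      rw [hφ]
      refine Finset.sum_congr rfl fun i _ => Finset.sum_congr rfl fun j _ => ?_
      exact mul_comm _ _
    | algebraMap r => exact entryEval.range.algebraMap_mem r
    | add x y hx hy h1 h2 => exact entryEval.range.add_mem h1 h2
    | mul x y hx hy h1 h2 => exact entryEval.range.mul_mem h1 h2
  rintro ⟨f, hf⟩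
  exact h f hf

/-- Restriction of polynomials to the rank one matrices `(xᵢ xⱼ)`. -/
def rankOne : MvPolynomial (Fin 3 × Fin 3) ℂ →ₐ[ℂ] MvPolynomial (Fin 3) ℂ :=
  aeval fun ij => X ij.1 * X ij.2

theorem pairMap_rankOne (m : MvPolynomial (Fin 3 × Fin 3) ℂ) :
    pairMap (rankOne m) = Ideal.Quotient.mk minorIdl (entryEval m) := by
  induction m using MvPolynomial.induction_on with
  | C a =>
    have h1 : rankOne (C a) = a • monomial 0 1 := by
      rw [rankOne, algHom_C, algebraMap_eq, smul_monomial, smul_eq_mul, mul_one, C_apply]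
    rw [h1, map_smul, pairMap_monomial, map_zero, entryEval, algHom_C]
    show a • (1 : polyFun (TForm 2) ⧸ minorIdl) = _
    rw [← Algebra.algebraMap_eq_smul_one]
    rfl
  | add p q hp hq => rw [map_add, map_add, map_add, map_add, hp, hq]
  | mul_X p ij hp =>
    have h1 : rankOne (X ij) = X ij.1 * X ij.2 := aeval_X _ _
    have h2 : entryEval (X ij) = univMatrix ij.1 ij.2 := aeval_X _ _
    rw [map_mul rankOne, map_mul entryEval, map_mul (Ideal.Quotient.mk minorIdl), ← hp, h1,
      pairMap_mul, h2]
    exact mul_comm (entryClass ij.1 ij.2) (pairMap (rankOne p))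

theorem entryEval_sq (m : MvPolynomial (Fin 3 × Fin 3) ℂ) (G : TForm 2)
    (l : MvPolynomial (Fin 3) ℂ) (hl : l ∈ TForm 1) (h : (G : MvPolynomial (Fin 3) ℂ) = l ^ 2) :
    (entryEval m).1 G = eval (fun i => constantCoeff (pderiv i l)) (rankOne m) := by
  induction m using MvPolynomial.induction_on with
  | C a => simp [entryEval, rankOne]
  | add p q hp hq => simp only [map_add, ← hp, ← hq]; rfl
  | mul_X p ij hp =>
    have h1 : (entryEval (X ij)).1 G = entryForm ij.1 ij.2 G := by
      rw [entryEval, aeval_X]; rfl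
    have h2 : eval (fun i => constantCoeff (pderiv i l)) (rankOne (X ij)) =
        entryForm ij.1 ij.2 G := by
      rw [rankOne, aeval_X, entryForm_sq _ _ G l hl h, eval_mul, eval_X, eval_X]
    rw [map_mul, map_mul, eval_mul, ← hp, h2, ← h1]
    rfl

theorem exists_veronese (l : MvPolynomial (Fin 3) ℂ) (hl : l ∈ TForm 1) (h0 : l ≠ 0)
    (hsq : l ^ 2 ∈ TForm 2) : ∃ p ∈ veronese, (⟨l ^ 2, hsq⟩ : TForm 2) ∈ p.submodule := by
  have hne : (⟨l ^ 2, hsq⟩ : TForm 2) ≠ 0 := by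
    intro h
    exact pow_ne_zero 2 h0 (congrArg Subtype.val h)
  refine ⟨Projectivization.mk ℂ _ hne, ?_, ?_⟩
  · obtain ⟨a, ha⟩ := Projectivization.exists_smul_eq_mk_rep ℂ _ hne
    obtain ⟨b, hb⟩ := IsAlgClosed.exists_pow_nat_eq (a : ℂ) (n := 2) two_pos
    refine ⟨b • l, Submodule.smul_mem _ b hl, ?_⟩
    rw [← ha, smul_pow, hb]
    rfl
  · rw [Projectivization.submodule_mk]
    exact Submodule.mem_span_singleton_self _

theorem minorIdl_eq : minorIdl = vanishingIdl veronese := by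
  apply le_antisymm
  · refine Ideal.span_le.2 ?_
    rintro _ ⟨⟨i, j⟩, rfl⟩ p ⟨l, hl, h⟩ w hw
    rw [← p.mk_rep, Projectivization.submodule_mk, Submodule.mem_span_singleton] at hw
    obtain ⟨c, rfl⟩ := hw
    have e : ∀ a b, (univMatrix a b).1 (c • p.rep) =
        c * (constantCoeff (pderiv a l) * constantCoeff (pderiv b l)) := by
      intro a b
      rw [← entryForm_sq a b p.rep l hl h]
      exact map_smul (entryForm a b) c p.rep
    rw [Matrix.adjugate_fin_three]
    fin_cases i <;> fin_cases j <;>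
      simp [e] <;> ring
  · intro f hf
    obtain ⟨m, rfl⟩ := entryEval_surjective f
    have h0 : rankOne m = 0 := by
      apply MvPolynomial.funext
      intro v
      have hl := linForm_mem v
      set l : MvPolynomial (Fin 3) ℂ := ∑ i, C (v i) * X i with hldef
      have hv : (fun i => constantCoeff (pderiv i l)) = v := by
        funext i
        fin_cases i <;> simp [hldef, Fin.sum_univ_three, pderiv_X]
      have hsq : l ^ 2 ∈ TForm 2 := by
        have : l.IsHomogeneous 1 := hl
        exact this.pow 2
      have h1 := entryEval_sq m ⟨l ^ 2, hsq⟩ l hl rfl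
      rw [hv] at h1
      rw [← h1, map_zero]
      by_cases hz : l = 0
      · obtain ⟨p, hp, -⟩ := exists_veronese (X 0) (isHomogeneous_X ℂ 0) (X_ne_zero 0)
          ((isHomogeneous_X ℂ 0).pow 2)
        refine hf p hp _ ?_
        have : (⟨l ^ 2, hsq⟩ : TForm 2) = 0 := by
          apply Subtype.ext
          simp [hz]
        rw [this]
        exact zero_mem _
      · obtain ⟨p, hp, hw⟩ := exists_veronese l hl hz hsq
        exact hf p hp _ hw
    rw [← Ideal.Quotient.eq_zero_iff_mem, ← pairMap_rankOne, h0, map_zero]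

/-- The `2 × 2` minors of the universal symmetric matrix (the entries of its adjugate matrix, up
to sign) are quadratic forms that generate the ideal of the Veronese surface. -/
def veroneseMinors : GeneratingForms veronese (Fin 3 × Fin 3) where
  degree := 2
  form ij := univMatrix.adjugate ij.1 ij.2
  isForm := by
    rintro ⟨i, j⟩ c w
    have e : ∀ a b, (univMatrix a b).1 (c • w) = c * (univMatrix a b).1 w := fun a b =>
      map_smul (entryForm a b) c w
    rw [Matrix.adjugate_fin_three]
    fin_cases i <;> fin_cases j <;>
      simp [e] <;> ring
  span_eq := minorIdl_eq

/-- The variety of complete conics: the blowup of the space of conics along the Veronese surface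
of double lines. -/
def completeConics : Set (ℙ ℂ (TForm 2) × ℙ ℂ (Fin 3 × Fin 3 → ℂ)) :=
  blowup veronese veroneseMinors

end

/-!
A conic is given by a symmetric `3 × 3` matrix `A`, and a complete conic by `A` together with a
symmetric matrix `B` that is the adjugate matrix of `A` unless `A` has rank one, in which case it
is any symmetric matrix with `AB = 0`, up to scalars. The fibre of the bundle at `(A, B)` is the
space of the fields `Az × H + B (z × K)` modulo the radial field, where `z` is the vector of the
coordinates and `H`, `K` are vectors of forms of degree `d - 1` (`completeFields`).

If `A` is invertible then `B = adj A` and `adj(A) (z × K) = Az × AK`, so that the fibre consists of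
the fields `Az × H`. They are the fields that leave the conic invariant, by the exactness of the
Koszul complex of the regular sequence formed by the entries of `Az`
(`range_conicMap_eq_invariantFields`). As the multiples of `Az` are in the kernel of
`H ↦ Az × H`, the dimension is at most `r = 3 dim S_{d-1} - dim S_{d-2}`.

The smooth conics are dense in the variety of complete conics, in the sense that a bihomogeneous
polynomial in `(A, B)` that vanishes at `(A, adj A)` for all invertible `A` vanishes at all complete
conics (`eq_zero_of_forall_smooth`, by deforming `A` to `A + ε I`). Thus the dimension is at most
`r` everywhere. It is also at least `r`: in each of the cases `rank A ≥ 2`, `rank A = 1 < rank B`,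
`rank A = rank B = 1` there is a linear map from triples of forms of degree `d - 1` to the fibre
whose kernel consists of the multiples of a vector of linear forms without common factor
(`fieldRank_le_finrank_completeFields`). A family of images of constant dimension is a subbundle
(`isSubbundle_completeFields`).

A smooth conic is irreducible, so by the Nullstellensatz the foliations that leave it invariant are
those defined by the fields in the fibre. Hence the locus of the foliations with an invariant smooth
conic is contained in the image of the projective bundle, and by density the image is contained in
the closure of this locus. Finally the image is closed by elimination theory, which is proved here
in the form needed, for equations that are bihomogeneous in `(A, B)` and linear in the field
(`exists_form_of_no_solution`).
-/

section CompleteConics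

open Matrix

/-! ### Ternary forms with shifted degrees -/

theorem homogeneousComponent_mul_isHomogeneous {σ : Type*} (p : MvPolynomial σ ℂ)
    {q : MvPolynomial σ ℂ} {k : ℕ} (hq : q.IsHomogeneous k) (n : ℕ) :
    homogeneousComponent (n + k) (p * q) = homogeneousComponent n p * q := by
  conv_lhs => rw [← sum_homogeneousComponent p]
  conv_rhs => rw [← sum_homogeneousComponent p]
  simp only [Finset.sum_mul, map_sum]
  refine Finset.sum_congr rfl fun i _ => ?_
  have h1 := homogeneousComponent_isHomogeneous i p
  rw [homogeneousComponent_of_mem (h1.mul hq), homogeneousComponent_of_mem h1]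
  by_cases h : i = n
  · simp [h]
  · rw [if_neg (by omega), if_neg (by omega), zero_mul]

theorem homogeneousComponent_mul_isHomogeneous_of_lt {σ : Type*} (p : MvPolynomial σ ℂ)
    {q : MvPolynomial σ ℂ} {k : ℕ} (hq : q.IsHomogeneous k) {m : ℕ} (hm : m < k) :
    homogeneousComponent m (p * q) = 0 := by
  conv_lhs => rw [← sum_homogeneousComponent p]
  simp only [Finset.sum_mul, map_sum]
  refine Finset.sum_eq_zero fun i _ => ?_
  have h1 := homogeneousComponent_isHomogeneous i p
  rw [homogeneousComponent_of_mem (h1.mul hq), if_neg (by omega)]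

/-- The space of ternary forms of degree `d - k`, understood to be zero if `d < k`. -/
def SForm (k d : ℕ) : Submodule ℂ (MvPolynomial (Fin 3) ℂ) where
  carrier := {p | ∀ j, j + k ≠ d → homogeneousComponent j p = 0}
  add_mem' ha hb j hj := by rw [map_add, ha j hj, hb j hj, add_zero]
  zero_mem' j _ := map_zero _
  smul_mem' c p hp j hj := by rw [map_smul, hp j hj, smul_zero]

theorem mem_SForm_zero {d : ℕ} {p : MvPolynomial (Fin 3) ℂ} : p ∈ SForm 0 d ↔ p ∈ TForm d := by
  constructor
  · intro h
    rw [← sum_homogeneousComponent p]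
    refine Submodule.sum_mem _ fun i _ => ?_
    by_cases hi : i = d
    · exact hi ▸ homogeneousComponent_isHomogeneous i p
    · rw [h i (by simpa using hi)]
      exact zero_mem _
  · intro h j hj
    rw [homogeneousComponent_of_mem h, if_neg]
    simpa [eq_comm] using hj

theorem mul_mem_SForm_iff {j k d : ℕ} {p a : MvPolynomial (Fin 3) ℂ} (ha : a ∈ TForm k)
    (h0 : a ≠ 0) : p * a ∈ SForm j d ↔ p ∈ SForm (k + j) d := by
  have ha' : a.IsHomogeneous k := ha
  constructor
  · intro h i hi
    have := h (i + k) (by omega)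
    rw [homogeneousComponent_mul_isHomogeneous p ha'] at this
    exact (mul_eq_zero.1 this).resolve_right h0
  · intro h i hi
    rcases lt_or_ge i k with hk | hk
    · exact homogeneousComponent_mul_isHomogeneous_of_lt p ha' hk
    · obtain ⟨m, rfl⟩ := Nat.exists_eq_add_of_le' hk
      rw [homogeneousComponent_mul_isHomogeneous p ha', h m (by omega), zero_mul]

theorem mul_mem_SForm {j k d : ℕ} {p a : MvPolynomial (Fin 3) ℂ} (ha : a ∈ TForm k)
    (hp : p ∈ SForm (k + j) d) : p * a ∈ SForm j d := by
  by_cases h0 : a = 0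
  · rw [h0, mul_zero]
    exact zero_mem _
  · exact (mul_mem_SForm_iff ha h0).2 hp

theorem mul_mem_TForm {d : ℕ} {p a : MvPolynomial (Fin 3) ℂ} (ha : a ∈ TForm 1)
    (hp : p ∈ SForm 1 d) : a * p ∈ TForm d := by
  rw [mul_comm]
  exact mem_SForm_zero.1 (mul_mem_SForm ha hp)

instance (d : ℕ) : FiniteDimensional ℂ (TForm d) :=
  Module.Finite.iff_fg.2 (homogeneousSubmodule_fg _ _ d)

instance (d : ℕ) : FiniteDimensional ℂ (VField d) :=
  inferInstanceAs (FiniteDimensional ℂ ((Fin 3 → TForm d) ⧸ radial d))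

instance (k d : ℕ) : FiniteDimensional ℂ (SForm k d) := by
  let f : SForm k d →ₗ[ℂ] TForm d :=
    { toFun := fun p => ⟨p.1 * X 0 ^ k, mem_SForm_zero.1 (mul_mem_SForm
        (show (X 0 ^ k : MvPolynomial (Fin 3) ℂ) ∈ TForm k from isHomogeneous_X_pow 0 k) p.2)⟩
      map_add' := fun p q => Subtype.ext (add_mul _ _ _)
      map_smul' := fun c p => Subtype.ext (smul_mul_assoc _ _ _) }
  refine FiniteDimensional.of_injective f fun p q h => Subtype.ext ?_
  exact mul_right_cancel₀ (pow_ne_zero k (X_ne_zero 0)) (congrArg Subtype.val h)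

/-- The component of degree `d - k` of a polynomial, understood to be zero if `d < k`. -/
noncomputable def projSForm (k d : ℕ) (p : MvPolynomial (Fin 3) ℂ) : MvPolynomial (Fin 3) ℂ :=
  if k ≤ d then homogeneousComponent (d - k) p else 0

theorem projSForm_mem (k d : ℕ) (p : MvPolynomial (Fin 3) ℂ) : projSForm k d p ∈ SForm k d := by
  intro j hj
  unfold projSForm
  split_ifs with h
  · rw [homogeneousComponent_of_mem (homogeneousComponent_isHomogeneous _ _), if_neg (by omega)]
  · exact map_zero _

theorem homogeneousComponent_mul_eq_projSForm {k d : ℕ} (p : MvPolynomial (Fin 3) ℂ)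
    {a : MvPolynomial (Fin 3) ℂ} (ha : a ∈ TForm k) :
    homogeneousComponent d (p * a) = projSForm k d p * a := by
  unfold projSForm
  split_ifs with h
  · obtain ⟨m, rfl⟩ := Nat.exists_eq_add_of_le' h
    rw [homogeneousComponent_mul_isHomogeneous p ha, Nat.add_sub_cancel]
  · rw [homogeneousComponent_mul_isHomogeneous_of_lt p ha (by omega), zero_mul]

/-! ### Vectors of linear forms -/

/-- The linear form with coefficient vector `a`. -/
noncomputable def lin (a : Fin 3 → ℂ) : MvPolynomial (Fin 3) ℂ := ∑ i, C (a i) * X i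

theorem lin_mem (a : Fin 3 → ℂ) : lin a ∈ TForm 1 := linForm_mem a

theorem lin_eq (a : Fin 3 → ℂ) : lin a = C (a 0) * X 0 + C (a 1) * X 1 + C (a 2) * X 2 :=
  Fin.sum_univ_three _

theorem eval_lin (a p : Fin 3 → ℂ) : eval p (lin a) = a ⬝ᵥ p := by
  simp [lin, dotProduct]

theorem lin_smul (c : ℂ) (a : Fin 3 → ℂ) : lin (c • a) = C c * lin a := by
  simp [lin, mul_assoc, Finset.mul_sum]

theorem lin_ne_zero {a : Fin 3 → ℂ} (ha : a ≠ 0) : lin a ≠ 0 := by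
  intro h
  refine ha (funext fun i => ?_)
  have := eval_lin a (Pi.single i 1)
  rw [h, map_zero, dotProduct_single_one] at this
  exact this.symm

theorem irreducible_lin {a : Fin 3 → ℂ} (ha : a ≠ 0) : Irreducible (lin a) := by
  have hdeg : (lin a).totalDegree = 1 := IsHomogeneous.totalDegree (lin_mem a) (lin_ne_zero ha)
  refine irreducible_of_totalDegree_eq_one hdeg fun x hx => ?_
  rw [isUnit_iff_ne_zero]
  rintro rfl
  refine lin_ne_zero ha (MvPolynomial.ext _ _ fun i => ?_)
  simpa using hx i

/-- Linear forms that are not proportional are coprime. -/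
theorem exists_eq_mul_lin {a b : Fin 3 → ℂ} (h : a ⨯₃ b ≠ 0) {p q : MvPolynomial (Fin 3) ℂ}
    (hpq : lin a * q = lin b * p) : ∃ L, p = L * lin a ∧ q = L * lin b := by
  have ha : a ≠ 0 := by
    rintro rfl
    simp at h
  have hprime : Prime (lin a) := (irreducible_lin ha).prime
  rcases hprime.dvd_or_dvd (Dvd.intro _ hpq) with h1 | h1
  · exfalso
    obtain ⟨c, hc⟩ := h1
    refine h (funext fun i => ?_)
    -- `b` vanishes at the points `a ⨯₃ eᵢ` of the line `a = 0`
    have := eval_lin b (a ⨯₃ Pi.single i 1)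
    rw [hc, map_mul, eval_lin, dot_self_cross, zero_mul] at this
    fin_cases i <;>
      simp [cross_apply, dotProduct, Fin.sum_univ_three] at this ⊢ <;> linear_combination this
  · obtain ⟨L, hL⟩ := h1
    refine ⟨L, by rw [hL, mul_comm], ?_⟩
    refine mul_left_cancel₀ (lin_ne_zero ha) ?_
    rw [hpq, hL]
    ring

/-- A vector of polynomials that is parallel to a vector of linear forms without common factor is
a multiple of it. -/
theorem exists_eq_mul_of_parallel {w : Fin 3 → Fin 3 → ℂ} {i j : Fin 3} (hij : w i ⨯₃ w j ≠ 0)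
    {H : Fin 3 → MvPolynomial (Fin 3) ℂ} (h : ∀ i j, lin (w i) * H j = lin (w j) * H i) :
    ∃ L, ∀ k, H k = L * lin (w k) := by
  obtain ⟨L, h1, -⟩ := exists_eq_mul_lin hij (h i j)
  have hi : w i ≠ 0 := by
    intro h0
    simp [h0] at hij
  refine ⟨L, fun k => mul_left_cancel₀ (lin_ne_zero hi) ?_⟩
  rw [h i k, h1]
  ring

/-- The exactness of the Koszul complex of `z₀, z₁, z₂` in the middle. -/
theorem exists_eq_cross_of_dot_eq_zero {y : Fin 3 → MvPolynomial (Fin 3) ℂ}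
    (h : X ⬝ᵥ y = 0) : ∃ K, y = X ⨯₃ K := by
  rw [dotProduct, Fin.sum_univ_three] at h
  have h0 : y 0 ∈ Ideal.span (X '' {1, 2} : Set (MvPolynomial (Fin 3) ℂ)) := by
    have hm : X 0 * y 0 ∈ Ideal.span (X '' {1, 2} : Set (MvPolynomial (Fin 3) ℂ)) := by
      have : X 0 * y 0 = (-y 1) * X 1 + (-y 2) * X 2 := by linear_combination h
      rw [this]
      exact add_mem (Ideal.mul_mem_left _ _ (Ideal.subset_span ⟨1, by simp, rfl⟩))
        (Ideal.mul_mem_left _ _ (Ideal.subset_span ⟨2, by simp, rfl⟩))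
    rw [mem_ideal_span_X_image] at hm ⊢
    intro m hms
    obtain ⟨i, hi, hne⟩ := hm (Finsupp.single 0 1 + m) (by
      rw [mem_support_iff, coeff_X_mul]
      exact mem_support_iff.1 hms)
    refine ⟨i, hi, ?_⟩
    have : (0 : Fin 3) ≠ i := by rintro rfl; simp at hi
    simpa [Finsupp.single_apply, this] using hne
  rw [Set.image_pair, Ideal.mem_span_pair] at h0
  obtain ⟨c, a, hca⟩ := h0
  have h2 : X 2 ∣ X 1 * (c * X 0 + y 1) :=
    ⟨-(a * X 0 + y 2), by rw [← hca] at h; linear_combination h⟩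
  have h3 : X 2 ∣ c * X 0 + y 1 := by
    refine ((X_prime (R := ℂ) (i := (2 : Fin 3))).dvd_or_dvd h2).resolve_left ?_
    intro hd
    have := X_dvd_X.1 hd
    simp at this
  obtain ⟨b, hb⟩ := h3
  have h4 : X 1 * b + a * X 0 + y 2 = 0 := by
    refine mul_left_cancel₀ (X_ne_zero (R := ℂ) (2 : Fin 3)) ?_
    rw [← hca] at h
    linear_combination h - X 1 * hb
  refine ⟨![b, -a, c], funext fun i => ?_⟩
  fin_cases i
  · simp [cross_apply]; linear_combination -hca
  · simp [cross_apply]; linear_combination hb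
  · simp [cross_apply]; linear_combination h4

/-! ### The fields attached to a complete conic -/

/-- The fields `Az × H`, for a matrix `A` and a vector `H` of forms of degree `d - 1`. -/
noncomputable def fieldA (d : ℕ) :
    Matrix (Fin 3) (Fin 3) ℂ →ₗ[ℂ] (Fin 3 → SForm 1 d) →ₗ[ℂ] (Fin 3 → TForm d) :=
  LinearMap.mk₂ ℂ
    (fun A H i => ⟨((fun i => lin (A i)) ⨯₃ fun i => (H i : MvPolynomial (Fin 3) ℂ)) i, by
      have h : ∀ i j, lin (A i) * (H j : MvPolynomial (Fin 3) ℂ) ∈ TForm d :=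
        fun i j => mul_mem_TForm (lin_mem _) (H j).2
      rw [cross_apply]
      fin_cases i <;> exact sub_mem (h _ _) (h _ _)⟩)
    (fun A A' H => by
      ext1 i
      ext1
      fin_cases i <;> simp [cross_apply, lin_eq] <;> ring)
    (fun c A H => by
      ext1 i
      ext1
      fin_cases i <;> simp [cross_apply, lin_eq, smul_eq_C_mul] <;> ring)
    (fun A H H' => by
      ext1 i
      ext1
      fin_cases i <;> simp [cross_apply] <;> ring)
    (fun c A H => by
      ext1 i
      ext1
      fin_cases i <;> simp [cross_apply, smul_eq_C_mul] <;> ring)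

theorem coe_fieldA {d : ℕ} (A : Matrix (Fin 3) (Fin 3) ℂ) (H : Fin 3 → SForm 1 d) (i : Fin 3) :
    (fieldA d A H i : MvPolynomial (Fin 3) ℂ) =
      ((fun i => lin (A i)) ⨯₃ fun i => (H i : MvPolynomial (Fin 3) ℂ)) i := rfl

/-- The fields `B (z × K)`, for a matrix `B` and a vector `K` of forms of degree `d - 1`. -/
noncomputable def fieldB (d : ℕ) :
    Matrix (Fin 3) (Fin 3) ℂ →ₗ[ℂ] (Fin 3 → SForm 1 d) →ₗ[ℂ] (Fin 3 → TForm d) :=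
  LinearMap.mk₂ ℂ
    (fun B K i => ⟨∑ j, C (B i j) * (X ⨯₃ fun i => (K i : MvPolynomial (Fin 3) ℂ)) j, by
      have h : ∀ i j, X i * (K j : MvPolynomial (Fin 3) ℂ) ∈ TForm d :=
        fun i j => mul_mem_TForm (isHomogeneous_X ℂ i) (K j).2
      refine sum_mem fun j _ => ?_
      rw [← smul_eq_C_mul, cross_apply]
      refine Submodule.smul_mem _ _ ?_
      fin_cases j <;> exact sub_mem (h _ _) (h _ _)⟩)
    (fun A A' H => by
      ext1 i
      ext1
      simp [add_mul, Finset.sum_add_distrib])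
    (fun c A H => by
      ext1 i
      ext1
      simp [smul_eq_C_mul, Finset.mul_sum, mul_assoc])
    (fun A H H' => by
      ext1 i
      ext1
      simp [cross_apply, Fin.sum_univ_three]
      ring)
    (fun c A H => by
      ext1 i
      ext1
      simp [cross_apply, Fin.sum_univ_three, smul_eq_C_mul]
      ring)

theorem coe_fieldB {d : ℕ} (B : Matrix (Fin 3) (Fin 3) ℂ) (K : Fin 3 → SForm 1 d) (i : Fin 3) :
    (fieldB d B K i : MvPolynomial (Fin 3) ℂ) =
      ∑ j, C (B i j) * (X ⨯₃ fun i => (K i : MvPolynomial (Fin 3) ℂ)) j := rfl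

/-- The linear map `(H, K) ↦ Az × H + B (z × K)` with values in the space of vector fields of
degree `d`. -/
noncomputable def conicMap (d : ℕ) (A B : Matrix (Fin 3) (Fin 3) ℂ) :
    (Fin 3 → SForm 1 d) × (Fin 3 → SForm 1 d) →ₗ[ℂ] VField d :=
  ((radial d).mkQ ∘ₗ fieldA d A).coprod ((radial d).mkQ ∘ₗ fieldB d B)

theorem conicMap_apply {d : ℕ} (A B : Matrix (Fin 3) (Fin 3) ℂ)
    (h : (Fin 3 → SForm 1 d) × (Fin 3 → SForm 1 d)) :
    conicMap d A B h = (radial d).mkQ (fieldA d A h.1) + (radial d).mkQ (fieldB d B h.2) := rfl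

theorem mkQ_radial_eq_zero {d : ℕ} {F : Fin 3 → TForm d} :
    (radial d).mkQ F = 0 ↔
      ∃ f : MvPolynomial (Fin 3) ℂ, ∀ i, (F i : MvPolynomial (Fin 3) ℂ) = f * X i := by
  rw [Submodule.mkQ_apply, Submodule.Quotient.mk_eq_zero]
  rfl

/-! ### The rank -/

/-- The rank of the bundle of fields attached to complete conics, namely
`3 dim S_{d-1} - dim S_{d-2}`. The subtraction is not truncated, since multiplication with a
variable embeds `S_{d-2}` into `S_{d-1}`. -/
noncomputable def fieldRank (d : ℕ) : ℕ :=
  3 * Module.finrank ℂ (SForm 1 d) - Module.finrank ℂ (SForm 2 d)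

/-- Multiplication of forms of degree `d - 2` with a vector of linear forms. -/
noncomputable def mulLin (d : ℕ) (w : Fin 3 → Fin 3 → ℂ) :
    SForm 2 d →ₗ[ℂ] (Fin 3 → SForm 1 d) where
  toFun L i := ⟨L.1 * lin (w i), mul_mem_SForm (lin_mem _) L.2⟩
  map_add' L L' := by
    ext1 i
    exact Subtype.ext (add_mul _ _ _)
  map_smul' c L := by
    ext1 i
    exact Subtype.ext (smul_mul_assoc _ _ _)

theorem finrank_range_add_finrank_ker_SForm {d : ℕ} {V : Type*} [AddCommGroup V] [Module ℂ V]
    (Ψ : (Fin 3 → SForm 1 d) →ₗ[ℂ] V) :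
    Module.finrank ℂ (LinearMap.range Ψ) + Module.finrank ℂ (LinearMap.ker Ψ) =
      3 * Module.finrank ℂ (SForm 1 d) := by
  rw [LinearMap.finrank_range_add_finrank_ker, Module.finrank_pi_fintype]
  simp

theorem fieldRank_le_finrank_range {d : ℕ} {V : Type*} [AddCommGroup V] [Module ℂ V]
    (Ψ : (Fin 3 → SForm 1 d) →ₗ[ℂ] V) {w : Fin 3 → Fin 3 → ℂ} {i j : Fin 3}
    (hij : w i ⨯₃ w j ≠ 0)
    (hker : ∀ H, Ψ H = 0 → ∀ i j, lin (w i) * (H j : MvPolynomial (Fin 3) ℂ) = lin (w j) * H i) :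
    fieldRank d ≤ Module.finrank ℂ (LinearMap.range Ψ) := by
  have hle : LinearMap.ker Ψ ≤ LinearMap.range (mulLin d w) := by
    intro H hH
    obtain ⟨L, hL⟩ := exists_eq_mul_of_parallel hij (hker H hH)
    have hi : w i ≠ 0 := by
      intro h0
      simp [h0] at hij
    refine ⟨⟨L, (mul_mem_SForm_iff (j := 1) (lin_mem (w i)) (lin_ne_zero hi)).1 ?_⟩, ?_⟩
    · rw [← hL]
      exact (H i).2
    · ext1 k
      exact Subtype.ext (hL k).symm
  have h1 := (Submodule.finrank_mono hle).trans (LinearMap.finrank_range_le _)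
  have h2 := finrank_range_add_finrank_ker_SForm Ψ
  unfold fieldRank
  omega

theorem finrank_range_le_fieldRank {d : ℕ} {V : Type*} [AddCommGroup V] [Module ℂ V]
    (Ψ : (Fin 3 → SForm 1 d) →ₗ[ℂ] V) {w : Fin 3 → Fin 3 → ℂ} (hw : w ≠ 0)
    (hker : ∀ L, Ψ (mulLin d w L) = 0) :
    Module.finrank ℂ (LinearMap.range Ψ) ≤ fieldRank d := by
  have hinj : Function.Injective (mulLin d w) := by
    obtain ⟨i, hi⟩ := Function.ne_iff.1 hw
    intro L L' h
    exact Subtype.ext (mul_right_cancel₀ (lin_ne_zero hi) (congrArg Subtype.val (congrFun h i)))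
  have hle : LinearMap.range (mulLin d w) ≤ LinearMap.ker Ψ := by
    rintro _ ⟨L, rfl⟩
    exact hker L
  have h1 := Submodule.finrank_mono hle
  rw [LinearMap.finrank_range_of_inj hinj] at h1
  have h2 := finrank_range_add_finrank_ker_SForm Ψ
  unfold fieldRank
  omega

theorem exists_cross_ne_zero {A : Matrix (Fin 3) (Fin 3) ℂ} (h : A.adjugate ≠ 0) :
    ∃ i j, A i ⨯₃ A j ≠ 0 := by
  by_contra! hA
  refine h ?_
  have h01 := hA 0 1
  have h02 := hA 0 2
  have h12 := hA 1 2
  simp only [cross_apply, ← List.ofFn_inj] at h01 h02 h12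
  simp at h01 h02 h12
  rw [adjugate_fin_three]
  ext i j
  fin_cases i <;> fin_cases j <;> simp <;>
    first
    | linear_combination h01.1
    | linear_combination h01.2.1
    | linear_combination h01.2.2
    | linear_combination h02.1
    | linear_combination h02.2.1
    | linear_combination h02.2.2
    | linear_combination h12.1
    | linear_combination h12.2.1
    | linear_combination h12.2.2
    | linear_combination -h01.1
    | linear_combination -h01.2.1
    | linear_combination -h01.2.2
    | linear_combination -h02.1
    | linear_combination -h02.2.1
    | linear_combination -h02.2.2

/-- A vector `y` of polynomials orthogonal to two constant vectors is parallel to their cross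
product. -/
theorem cross_parallel (a b : Fin 3 → ℂ) (y : Fin 3 → MvPolynomial (Fin 3) ℂ)
    (ha : ∑ j, C (a j) * y j = 0) (hb : ∑ j, C (b j) * y j = 0) (p q : Fin 3) :
    C ((a ⨯₃ b) p) * y q = C ((a ⨯₃ b) q) * y p := by
  rw [Fin.sum_univ_three] at ha hb
  fin_cases p <;> fin_cases q <;> simp [cross_apply]
  · linear_combination C (b 2) * ha - C (a 2) * hb
  · linear_combination C (a 1) * hb - C (b 1) * ha
  · linear_combination C (a 2) * hb - C (b 2) * ha
  · linear_combination C (b 0) * ha - C (a 0) * hb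
  · linear_combination C (b 1) * ha - C (a 1) * hb
  · linear_combination C (a 0) * hb - C (b 0) * ha

theorem eq_smul_of_cross_eq_zero {H : Fin 3 → MvPolynomial (Fin 3) ℂ}
    {w : Fin 3 → MvPolynomial (Fin 3) ℂ} (h : w ⨯₃ H = 0) (i j : Fin 3) :
    w i * H j = w j * H i := by
  rw [cross_apply] at h
  have h0 := congrFun h 0
  have h1 := congrFun h 1
  have h2 := congrFun h 2
  simp at h0 h1 h2
  fin_cases i <;> fin_cases j <;> simp <;>
    first
    | linear_combination h0
    | linear_combination h1
    | linear_combination h2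
    | linear_combination -h0
    | linear_combination -h1
    | linear_combination -h2

theorem X_eq_lin (i : Fin 3) : (X i : MvPolynomial (Fin 3) ℂ) = lin (Pi.single i 1) := by
  simp [lin, Pi.single_apply]

/-- If `A` has rank at least two then the fields `Az × H` span a space of the expected
dimension, since `Az` has no common factor. -/
theorem fieldRank_le_of_adjugate_left_ne_zero (d : ℕ) {A : Matrix (Fin 3) (Fin 3) ℂ}
    (B : Matrix (Fin 3) (Fin 3) ℂ) (hq : X ⬝ᵥ (fun i => lin (A i)) ≠ 0) (hA : A.adjugate ≠ 0) :
    fieldRank d ≤ Module.finrank ℂ (LinearMap.range (conicMap d A B)) := by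
  obtain ⟨i, j, hij⟩ := exists_cross_ne_zero hA
  refine (fieldRank_le_finrank_range ((radial d).mkQ ∘ₗ fieldA d A) hij fun H hH => ?_).trans
    (Submodule.finrank_mono ?_)
  · obtain ⟨f, hf⟩ := mkQ_radial_eq_zero.1 hH
    have h1 : (fun i => lin (A i)) ⨯₃ (fun i => (H i : MvPolynomial (Fin 3) ℂ)) = f • X :=
      funext hf
    have h2 : f = 0 := by
      have h3 := dot_self_cross (fun i => lin (A i)) (fun i => (H i : MvPolynomial (Fin 3) ℂ))
      rw [h1, dotProduct_smul, dotProduct_comm, smul_eq_mul] at h3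
      exact (mul_eq_zero.1 h3).resolve_right hq
    rw [h2, zero_smul] at h1
    exact eq_smul_of_cross_eq_zero h1
  · rintro _ ⟨H, rfl⟩
    exact ⟨(H, 0), by simp [conicMap]⟩

/-- If `A` and `B` have rank one and at least two, respectively, and `AB = 0`, then the fields
`B (z × K)` span a space of the expected dimension. -/
theorem fieldRank_le_of_adjugate_right_ne_zero (d : ℕ) {A B : Matrix (Fin 3) (Fin 3) ℂ}
    (hA : A ≠ 0) (hAB : A * B = 0) (hB : B.adjugate ≠ 0) :
    fieldRank d ≤ Module.finrank ℂ (LinearMap.range (conicMap d A B)) := by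
  obtain ⟨i, j, hij⟩ := exists_cross_ne_zero hB
  have h01 : (Pi.single 0 1 : Fin 3 → ℂ) ⨯₃ Pi.single 1 1 ≠ 0 := by
    intro h
    have := congrFun h 2
    simp [cross_apply] at this
  refine (fieldRank_le_finrank_range ((radial d).mkQ ∘ₗ fieldB d B)
    (w := fun i => Pi.single i 1) h01 fun K hK => ?_).trans (Submodule.finrank_mono ?_)
  · obtain ⟨f, hf⟩ := mkQ_radial_eq_zero.1 hK
    simp only [coe_fieldB] at hf
    set y := X ⨯₃ fun i => (K i : MvPolynomial (Fin 3) ℂ) with hy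
    have h2 : f = 0 := by
      obtain ⟨p, hp⟩ := Function.ne_iff.1 hA
      have h3 : f * lin (A p) = 0 := by
        have h4 : ∀ k, ∑ i, C (A p i) * C (B i k) = (0 : MvPolynomial (Fin 3) ℂ) := by
          intro k
          simp only [← map_mul, ← map_sum]
          rw [show ∑ i, A p i * B i k = (A * B) p k from rfl, hAB]
          simp
        calc f * lin (A p) = ∑ i, C (A p i) * (f * X i) := by
              rw [lin, Finset.mul_sum]
              exact Finset.sum_congr rfl fun i _ => by ring
          _ = ∑ i, C (A p i) * ∑ k, C (B i k) * y k :=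
              Finset.sum_congr rfl fun i _ => by rw [← hf]
          _ = ∑ k, (∑ i, C (A p i) * C (B i k)) * y k := by
              simp only [Finset.mul_sum, Finset.sum_mul]
              rw [Finset.sum_comm]
              simp only [mul_assoc]
          _ = 0 := by simp [h4]
      exact (mul_eq_zero.1 h3).resolve_right (lin_ne_zero hp)
    simp only [h2, zero_mul] at hf
    have hpar := cross_parallel (B i) (B j) y (hf i) (hf j)
    have hyX : X ⬝ᵥ y = 0 := dot_self_cross _ _
    rw [dotProduct, Fin.sum_univ_three] at hyX
    have hy0 : y = 0 := by
      funext q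
      -- `(n ⬝ z) y = (z ⬝ y) n = 0` for the constant vector `n` parallel to `y`
      have h5 : lin (B i ⨯₃ B j) * y q = 0 := by
        rw [lin_eq]
        linear_combination X 0 * hpar 0 q + X 1 * hpar 1 q + X 2 * hpar 2 q +
          C ((B i ⨯₃ B j) q) * hyX
      exact (mul_eq_zero.1 h5).resolve_left (lin_ne_zero hij)
    simp only [← X_eq_lin]
    exact eq_smul_of_cross_eq_zero hy0
  · rintro _ ⟨K, rfl⟩
    exact ⟨(0, K), by simp [conicMap]⟩

theorem exists_dotProduct_eq_one {v : Fin 3 → ℂ} (hv : v ≠ 0) : ∃ h : Fin 3 → ℂ, h ⬝ᵥ v = 1 := by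
  obtain ⟨i, hi⟩ := Function.ne_iff.1 hv
  exact ⟨Pi.single i (v i)⁻¹, by rw [single_dotProduct, inv_mul_cancel₀ hi]⟩

/-- If `A = l lᵗ` and `B = v vᵗ` with `l ⬝ v = 0` then the space contains the fields
`l b u + (l q + m q') v`, where `u, v` is a basis of the plane orthogonal to `l` and `l, m` is a
basis of the plane orthogonal to `v`. They form a space of the expected dimension. -/
theorem fieldRank_le_of_rank_one (d : ℕ) {l v : Fin 3 → ℂ} (hl : l ≠ 0) (hv : v ≠ 0)
    (hlv : l ⬝ᵥ v = 0) :
    fieldRank d ≤ Module.finrank ℂ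
      (LinearMap.range (conicMap d (vecMulVec l l) (vecMulVec v v))) := by
  obtain ⟨h, hh⟩ := exists_dotProduct_eq_one hv
  obtain ⟨k, hk⟩ := exists_dotProduct_eq_one hl
  obtain ⟨u, hu⟩ : ∃ u, u = l ⨯₃ h := ⟨_, rfl⟩
  obtain ⟨m, hm⟩ : ∃ m, m = k ⨯₃ v := ⟨_, rfl⟩
  have hlu : l ⬝ᵥ u = 0 := by rw [hu, dot_self_cross]
  have hhu : h ⬝ᵥ u = 0 := by rw [hu, dot_cross_self]
  have huv : u ⨯₃ v = -l := by
    rw [hu, cross_cross_eq_smul_sub_smul, hlv, hh, zero_smul, one_smul, zero_sub]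
  have hml : m ⨯₃ l = v := by
    rw [hm, cross_cross_eq_smul_sub_smul, hk, dotProduct_comm v l, hlv, zero_smul, one_smul,
      sub_zero]
  have hu0 : u ≠ 0 := by
    rintro rfl
    refine hl ?_
    simpa using huv.symm
  let T : (Fin 3 → SForm 1 d) →ₗ[ℂ] (Fin 3 → SForm 1 d) × (Fin 3 → SForm 1 d) :=
    LinearMap.prod (LinearMap.pi fun i => h i • LinearMap.proj 0)
      (LinearMap.pi fun i => -u i • LinearMap.proj 1 + k i • LinearMap.proj 2)
  have hw : (![0, m, -l] : Fin 3 → Fin 3 → ℂ) 1 ⨯₃ (![0, m, -l] : Fin 3 → Fin 3 → ℂ) 2 ≠ 0 := by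
    show m ⨯₃ (-l) ≠ 0
    rw [map_neg, hml]
    exact neg_ne_zero.2 hv
  refine (fieldRank_le_finrank_range (conicMap d _ _ ∘ₗ T) hw fun H hH => ?_).trans
    (Submodule.finrank_mono (LinearMap.range_comp_le_range _ _))
  rw [LinearMap.comp_apply, conicMap_apply, ← map_add] at hH
  obtain ⟨f, hf⟩ := mkQ_radial_eq_zero.1 hH
  have hC : ∀ {a b : Fin 3 → ℂ} {c : ℂ}, a ⬝ᵥ b = c →
      C (a 0) * C (b 0) + C (a 1) * C (b 1) + C (a 2) * C (b 2) =
        (C c : MvPolynomial (Fin 3) ℂ) := by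
    intro a b c hc
    rw [← hc, dotProduct, Fin.sum_univ_three]
    simp
  have hf' : ∀ i, lin l * (H 0).1 * C (u i) +
      C (v i) * (lin l * (H 1).1 + lin m * (H 2).1) = f * X i := by
    intro i
    rw [← hf]
    have c0 : C (l 0) = -(C (u 1) * C (v 2) - C (u 2) * C (v 1) : MvPolynomial (Fin 3) ℂ) := by
      rw [← map_mul, ← map_mul, ← map_sub, ← map_neg]
      congr 1
      simpa [cross_apply] using congrArg Neg.neg (congrFun huv.symm 0)
    have c1 : C (l 1) = -(C (u 2) * C (v 0) - C (u 0) * C (v 2) : MvPolynomial (Fin 3) ℂ) := by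
      rw [← map_mul, ← map_mul, ← map_sub, ← map_neg]
      congr 1
      simpa [cross_apply] using congrArg Neg.neg (congrFun huv.symm 1)
    have c2 : C (l 2) = -(C (u 0) * C (v 1) - C (u 1) * C (v 0) : MvPolynomial (Fin 3) ℂ) := by
      rw [← map_mul, ← map_mul, ← map_sub, ← map_neg]
      congr 1
      simpa [cross_apply] using congrArg Neg.neg (congrFun huv.symm 2)
    have eA : (fieldA d (vecMulVec l l) (T H).1 i : MvPolynomial (Fin 3) ℂ) =
        lin l * (H 0).1 * C (u i) := by
      have hl' : ∀ i, lin (vecMulVec l l i) = C (l i) * lin l := fun i => lin_smul (l i) l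
      rw [coe_fieldA]
      simp only [hl']
      fin_cases i <;> simp [T, cross_apply, hu, smul_eq_C_mul] <;> ring
    have eB : (fieldB d (vecMulVec v v) (T H).2 i : MvPolynomial (Fin 3) ℂ) =
        C (v i) * (lin l * (H 1).1 + lin m * (H 2).1) := by
      rw [coe_fieldB, lin_eq l, c0, c1, c2, lin_eq m, hm]
      simp [T, cross_apply, smul_eq_C_mul, Fin.sum_univ_three, vecMulVec_apply]
      ring
    rw [Pi.add_apply, Submodule.coe_add, eA, eB]
  have hlu' := hC hlu
  have hlv' := hC hlv
  have hhu' := hC hhu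
  have hhv' := hC hh
  rw [map_zero] at hlu' hlv' hhu'
  rw [map_one] at hhv'
  have f0 := hf' 0
  have f1 := hf' 1
  have f2 := hf' 2
  have hf0 : f = 0 := by
    refine (mul_eq_zero.1 (?_ : f * lin l = 0)).resolve_right (lin_ne_zero hl)
    conv_lhs => rw [lin_eq l]
    linear_combination -C (l 0) * f0 - C (l 1) * f1 - C (l 2) * f2 +
      lin l * (H 0).1 * hlu' + (lin l * (H 1).1 + lin m * (H 2).1) * hlv'
  simp only [hf0, zero_mul] at f0 f1 f2 hf'
  have hq : lin l * (H 1).1 + lin m * (H 2).1 = 0 := by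
    linear_combination C (h 0) * f0 + C (h 1) * f1 + C (h 2) * f2 -
      lin l * (H 0).1 * hhu' - (lin l * (H 1).1 + lin m * (H 2).1) * hhv'
  have hb : (H 0).1 = 0 := by
    obtain ⟨i, hi⟩ := Function.ne_iff.1 hu0
    have := hf' i
    rw [hq, mul_zero, add_zero] at this
    refine (mul_eq_zero.1 ((mul_eq_zero.1 this).resolve_right ?_)).resolve_left (lin_ne_zero hl)
    exact fun h0 => hi (C_injective _ _ (h0.trans C_0.symm))
  have hneg : lin (-l) = -lin l := by simp [lin]
  have hz : lin 0 = 0 := by simp [lin]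
  intro i j
  fin_cases i <;> fin_cases j <;> simp [hb, hneg, hz] <;>
    first
    | linear_combination hq
    | linear_combination -hq

/-! ### Smooth conics and the fields that leave them invariant -/

/-- The symmetric matrix of a quadratic form. -/
noncomputable def symM : TForm 2 →ₗ[ℂ] Matrix (Fin 3) (Fin 3) ℂ :=
  LinearMap.pi fun i => LinearMap.pi fun j => entryForm i j

theorem symM_apply (G : TForm 2) (i j : Fin 3) : symM G i j = entryForm i j G := rfl

theorem symM_transpose (G : TForm 2) : (symM G)ᵀ = symM G := by
  ext i j
  rw [transpose_apply, symM_apply, symM_apply, entryForm_symm]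

theorem symM_comm (G : TForm 2) (i j : Fin 3) : symM G i j = symM G j i := by
  rw [symM_apply, symM_apply, entryForm_symm]

theorem dotProduct_lin_symM (G : TForm 2) :
    X ⬝ᵥ (fun i => lin (symM G i)) = (G : MvPolynomial (Fin 3) ℂ) := by
  rw [entry_expansion G, dotProduct]
  refine Finset.sum_congr rfl fun i _ => ?_
  rw [lin, Finset.mul_sum]
  refine Finset.sum_congr rfl fun j _ => ?_
  rw [smul_eq_C_mul, symM_apply]
  ring

theorem pderiv_eq_lin (G : TForm 2) (i : Fin 3) :
    pderiv i (G : MvPolynomial (Fin 3) ℂ) = 2 * lin (symM G i) := by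
  conv_lhs => rw [← dotProduct_lin_symM G]
  have h01 := symM_comm G 0 1
  have h02 := symM_comm G 0 2
  have h12 := symM_comm G 1 2
  simp only [dotProduct, Fin.sum_univ_three, lin_eq]
  fin_cases i <;> simp [pderiv_X, h01, h02, h12] <;> ring

theorem symM_injective : Function.Injective symM := by
  intro G G' h
  apply Subtype.ext
  rw [← dotProduct_lin_symM G, ← dotProduct_lin_symM G', h]

theorem eval_pderiv_eq (G : TForm 2) (i : Fin 3) (p : Fin 3 → ℂ) :
    eval p (pderiv i (G : MvPolynomial (Fin 3) ℂ)) = 2 * (symM G *ᵥ p) i := by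
  rw [pderiv_eq_lin, map_mul, eval_lin]
  simp [mulVec]

theorem eval_eq_dotProduct (G : TForm 2) (p : Fin 3 → ℂ) :
    eval p (G : MvPolynomial (Fin 3) ℂ) = p ⬝ᵥ (symM G *ᵥ p) := by
  conv_lhs => rw [← dotProduct_lin_symM G]
  simp [dotProduct, mulVec, eval_lin]

theorem smoothConic_iff (G : TForm 2) : SmoothConic G ↔ (symM G).det ≠ 0 := by
  constructor
  · intro h h0
    obtain ⟨p, hp, hp'⟩ := exists_mulVec_eq_zero_iff.2 h0
    obtain ⟨i, hi⟩ := h p hp (by rw [eval_eq_dotProduct, hp', dotProduct_zero])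
    refine hi ?_
    rw [eval_pderiv_eq, hp', Pi.zero_apply, mul_zero]
  · intro h p hp _
    by_contra! h'
    refine h (exists_mulVec_eq_zero_iff.1 ⟨p, hp, funext fun i => ?_⟩)
    have := h' i
    rw [eval_pderiv_eq] at this
    simpa using this

theorem exists_eq_lin {l : MvPolynomial (Fin 3) ℂ} (hl : l ∈ TForm 1) : ∃ a, l = lin a := by
  rw [TForm, homogeneousSubmodule_one_eq_span_X, Submodule.mem_span_range_iff_exists_fun] at hl
  obtain ⟨a, rfl⟩ := hl
  exact ⟨a, by simp [lin, smul_eq_C_mul]⟩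

theorem SmoothConic.ne_zero {G : TForm 2} (hG : SmoothConic G) :
    (G : MvPolynomial (Fin 3) ℂ) ≠ 0 := by
  intro h
  obtain ⟨i, hi⟩ := hG (fun _ => 1) (fun h => one_ne_zero (congrFun h 0)) (by rw [h, map_zero])
  simp [h] at hi

/-- A product of two linear forms is singular at a common zero, so a smooth conic is
irreducible. -/
theorem SmoothConic.irreducible {G : TForm 2} (hG : SmoothConic G) :
    Irreducible (G : MvPolynomial (Fin 3) ℂ) := by
  have hhom : (G : MvPolynomial (Fin 3) ℂ).IsHomogeneous 2 := G.2
  have hdeg : (G : MvPolynomial (Fin 3) ℂ).totalDegree = 2 := hhom.totalDegree hG.ne_zero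
  have hunit : ∀ p q : MvPolynomial (Fin 3) ℂ, (G : MvPolynomial (Fin 3) ℂ) = p * q →
      p.totalDegree = 0 → IsUnit p := by
    intro p q hpq hp
    rw [totalDegree_eq_zero_iff_eq_C] at hp
    rw [hp]
    refine IsUnit.map C (isUnit_iff_ne_zero.2 fun h0 => ?_)
    rw [h0, C_0] at hp
    exact hG.ne_zero (by rw [hpq, hp, zero_mul])
  refine ⟨fun hu => ?_, fun p q hpq => ?_⟩
  · obtain ⟨c, -, hc⟩ := isUnit_iff_eq_C_of_isReduced.1 hu
    rw [hc, totalDegree_C] at hdeg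
    omega
  have hp0 : p ≠ 0 := by
    rintro rfl
    exact hG.ne_zero (by rw [hpq, zero_mul])
  have hq0 : q ≠ 0 := by
    rintro rfl
    exact hG.ne_zero (by rw [hpq, mul_zero])
  have hsum : p.totalDegree + q.totalDegree = 2 := by
    rw [← totalDegree_mul_of_isDomain hp0 hq0, ← hpq, hdeg]
  by_cases h1 : p.totalDegree = 0
  · exact Or.inl (hunit p q hpq h1)
  by_cases h2 : q.totalDegree = 0
  · exact Or.inr (hunit q p (by rw [hpq, mul_comm]) h2)
  exfalso
  have h1' : p.totalDegree = 1 := by omega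
  have h2' : q.totalDegree = 1 := by omega
  have hq : q = homogeneousComponent 0 q + homogeneousComponent 1 q := by
    conv_lhs => rw [← sum_homogeneousComponent q, h2', Finset.sum_range_succ, Finset.sum_range_one]
  have hlm : (G : MvPolynomial (Fin 3) ℂ) =
      homogeneousComponent 1 p * homogeneousComponent 1 q := by
    calc (G : MvPolynomial (Fin 3) ℂ) = homogeneousComponent 2 (p * q) := by
          rw [← hpq, homogeneousComponent_eq_self G.2]
      _ = homogeneousComponent 2 (p * homogeneousComponent 0 q) +
          homogeneousComponent 2 (p * homogeneousComponent 1 q) := by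
          conv_lhs => rw [hq, mul_add, map_add]
      _ = _ := by
          rw [homogeneousComponent_mul_isHomogeneous p (homogeneousComponent_isHomogeneous 0 q) 2,
            homogeneousComponent_mul_isHomogeneous p (homogeneousComponent_isHomogeneous 1 q) 1,
            homogeneousComponent_eq_zero 2 p (by omega), zero_mul, zero_add]
  obtain ⟨a, ha⟩ := exists_eq_lin (homogeneousComponent_isHomogeneous 1 p)
  obtain ⟨b, hb⟩ := exists_eq_lin (homogeneousComponent_isHomogeneous 1 q)
  rw [ha, hb] at hlm
  obtain ⟨x, hx, hx'⟩ := exists_mulVec_eq_zero_iff.2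
    (det_eq_zero_of_row_eq_zero (A := Matrix.of ![a, b, 0]) 2 fun j => rfl)
  have hax : eval x (lin a) = 0 := by
    rw [eval_lin]
    exact congrFun hx' 0
  have hbx : eval x (lin b) = 0 := by
    rw [eval_lin]
    exact congrFun hx' 1
  obtain ⟨i, hi⟩ := hG x hx (by rw [hlm, map_mul, hax, zero_mul])
  refine hi ?_
  rw [hlm]
  simp [Derivation.leibniz, hax, hbx]

/-- A polynomial that vanishes on a smooth conic is divisible by its equation. -/
theorem SmoothConic.dvd_of_eval_eq_zero {G : TForm 2} (hG : SmoothConic G)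
    {p : MvPolynomial (Fin 3) ℂ}
    (hp : ∀ x, eval x (G : MvPolynomial (Fin 3) ℂ) = 0 → eval x p = 0) :
    (G : MvPolynomial (Fin 3) ℂ) ∣ p := by
  have hprime : (Ideal.span {(G : MvPolynomial (Fin 3) ℂ)}).IsPrime :=
    (Ideal.span_singleton_prime hG.ne_zero).2 hG.irreducible.prime
  rw [← Ideal.mem_span_singleton, ← hprime.radical,
    ← vanishingIdeal_zeroLocus_eq_radical (K := ℂ), mem_vanishingIdeal_iff]
  intro x hx
  rw [aeval_eq_eval]
  refine hp x ?_
  have := hx _ (Ideal.mem_span_singleton_self _)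
  rwa [aeval_eq_eval] at this

theorem mkQ_mem_invariantFields {d : ℕ} {G : TForm 2} {F : Fin 3 → TForm d} :
    (radial d).mkQ F ∈ invariantFields d G ↔ (G : MvPolynomial (Fin 3) ℂ) ∣
      ∑ i, (F i : MvPolynomial (Fin 3) ℂ) * pderiv i (G : MvPolynomial (Fin 3) ℂ) := by
  rw [invariantFields, LinearMap.mem_ker, thetaBar, Submodule.mkQ_apply, Submodule.mapQ_apply,
    Submodule.Quotient.mk_eq_zero]
  rfl

/-- At a point where the field is radial, Euler's formula shows that it is tangent to the conic, so
that the invariance condition holds at all points of the conic. -/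
theorem SmoothConic.isInvariantConic_iff {d : ℕ} {G : TForm 2} (hG : SmoothConic G)
    {F : Fin 3 → TForm d} :
    IsInvariantConic F G ↔ (radial d).mkQ F ∈ invariantFields d G := by
  rw [mkQ_mem_invariantFields]
  constructor
  · intro h
    refine hG.dvd_of_eval_eq_zero fun p hp => ?_
    simp only [map_sum, map_mul]
    by_cases hp0 : p = 0
    · refine Finset.sum_eq_zero fun i _ => ?_
      rw [eval_pderiv_eq, hp0, mulVec_zero, Pi.zero_apply, mul_zero, mul_zero]
    by_cases hc : ∃ c : ℂ, ∀ i, eval p (F i : MvPolynomial (Fin 3) ℂ) = c * p i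
    · obtain ⟨c, hc⟩ := hc
      rw [eval_eq_dotProduct, dotProduct] at hp
      calc _ = ∑ i, 2 * c * (p i * (symM G *ᵥ p) i) :=
            Finset.sum_congr rfl fun i _ => by rw [hc, eval_pderiv_eq]; ring
        _ = 0 := by rw [← Finset.mul_sum, hp, mul_zero]
    · exact h p hp0 hp (hG p hp0 hp) hc
  · rintro ⟨q, hq⟩ p _ hp _ _
    have := congrArg (eval p) hq
    simpa [hp] using this

theorem mem_smoothConicLocus_iff {d : ℕ} {ξ : ℙ ℂ (VField d)} :
    ξ ∈ smoothConicLocus d ↔ ∃ G, SmoothConic G ∧ ξ.rep ∈ invariantFields d G := by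
  constructor
  · rintro ⟨F, G, hF, hG, h⟩
    exact ⟨G, hG, hF ▸ hG.isInvariantConic_iff.1 h⟩
  · rintro ⟨G, hG, h⟩
    obtain ⟨F, hF⟩ := (radial d).mkQ_surjective ξ.rep
    exact ⟨F, G, hF, hG, hG.isInvariantConic_iff.2 (hF ▸ h)⟩

theorem invariantFields_smul {d : ℕ} {G : TForm 2} {c : ℂ} (hc : c ≠ 0) :
    invariantFields d (c • G) = invariantFields d G := by
  ext v
  obtain ⟨F, rfl⟩ := (radial d).mkQ_surjective v
  have hu : IsUnit (C c : MvPolynomial (Fin 3) ℂ) := (isUnit_iff_ne_zero.2 hc).map C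
  rw [mkQ_mem_invariantFields, mkQ_mem_invariantFields]
  simp only [Submodule.coe_smul, smul_eq_C_mul, pderiv_C_mul]
  rw [hu.mul_left_dvd]
  simp only [mul_left_comm _ (C c), ← Finset.mul_sum]
  rw [hu.dvd_mul_left]

theorem cross_mulVec {R : Type*} [CommRing R] (A : Matrix (Fin 3) (Fin 3) R) (x y : Fin 3 → R) :
    (A *ᵥ x) ⨯₃ (A *ᵥ y) = (A.adjugate)ᵀ *ᵥ (x ⨯₃ y) := by
  rw [adjugate_fin_three]
  funext i
  fin_cases i <;> simp [cross_apply, mulVec, dotProduct, Fin.sum_univ_three] <;> ring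

theorem lin_eq_mulVec (A : Matrix (Fin 3) (Fin 3) ℂ) (i : Fin 3) :
    lin (A i) = (A.map C *ᵥ X) i := by
  simp [lin, mulVec, dotProduct]

theorem coe_fieldB_eq_mulVec {d : ℕ} (B : Matrix (Fin 3) (Fin 3) ℂ) (K : Fin 3 → SForm 1 d)
    (i : Fin 3) : (fieldB d B K i : MvPolynomial (Fin 3) ℂ) =
      (B.map C *ᵥ (X ⨯₃ fun i => (K i : MvPolynomial (Fin 3) ℂ))) i := by
  rw [coe_fieldB]
  simp [mulVec, dotProduct]

/-- For symmetric `A` one has `adj(A) (z × K) = Az × AK`. -/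
theorem fieldB_adjugate {d : ℕ} {A : Matrix (Fin 3) (Fin 3) ℂ} (hA : Aᵀ = A)
    (K : Fin 3 → SForm 1 d) :
    fieldB d A.adjugate K = fieldA d A (fun i => ∑ j, A i j • K j) := by
  ext1 i
  ext1
  have h1 : (A.map C *ᵥ fun i => (K i : MvPolynomial (Fin 3) ℂ)) =
      fun i => ((∑ j, A i j • K j : SForm 1 d) : MvPolynomial (Fin 3) ℂ) := by
    funext i
    simp [mulVec, dotProduct, smul_eq_C_mul]
  have h2 : A.adjugate.map C = ((A.map (C : ℂ →+* MvPolynomial (Fin 3) ℂ)).adjugate)ᵀ := by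
    rw [adjugate_transpose, ← transpose_map, hA]
    exact RingHom.map_adjugate C A
  rw [coe_fieldA, coe_fieldB_eq_mulVec, ← h1, h2, ← cross_mulVec]
  simp only [lin_eq_mulVec]

/-- The fields that leave the smooth conic with matrix `A` invariant are the fields `Az × H`, by
the exactness of the Koszul complex. -/
theorem range_conicMap_eq_invariantFields {d : ℕ} {G : TForm 2} (hG : (symM G).det ≠ 0) (c : ℂ) :
    LinearMap.range (conicMap d (symM G) (c • (symM G).adjugate)) = invariantFields d G := by
  set A := symM G with hA
  have hAt : Aᵀ = A := symM_transpose G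
  have hB : ∀ K, fieldB d (c • A.adjugate) K = fieldA d A (c • fun i => ∑ j, A i j • K j) := by
    intro K
    rw [map_smul, map_smul, LinearMap.smul_apply, fieldB_adjugate hAt]
  apply le_antisymm
  · rintro _ ⟨⟨H, K⟩, rfl⟩
    rw [conicMap_apply, hB, ← map_add, ← map_add, mkQ_mem_invariantFields]
    refine ⟨0, ?_⟩
    set L := H + c • fun i => ∑ j, A i j • K j
    have h1 := dot_self_cross (fun i => lin (A i)) (fun i => (L i : MvPolynomial (Fin 3) ℂ))
    rw [dotProduct] at h1
    calc _ = 2 * ∑ i, lin (A i) *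
          ((fun i => lin (A i)) ⨯₃ fun i => (L i : MvPolynomial (Fin 3) ℂ)) i := by
          rw [Finset.mul_sum]
          refine Finset.sum_congr rfl fun i _ => ?_
          rw [pderiv_eq_lin, coe_fieldA]
          ring
      _ = _ := by rw [h1, mul_zero, mul_zero]
  · intro v hv
    obtain ⟨F, rfl⟩ := (radial d).mkQ_surjective v
    rw [mkQ_mem_invariantFields] at hv
    obtain ⟨Q, hQ⟩ := hv
    set Ap : Matrix (Fin 3) (Fin 3) (MvPolynomial (Fin 3) ℂ) := A.map C with hAp
    set f : Fin 3 → MvPolynomial (Fin 3) ℂ := fun i => F i with hf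
    have hApt : Apᵀ = Ap := by rw [hAp, ← transpose_map, hAt]
    have hGX : X ⬝ᵥ (Ap *ᵥ X) = (G : MvPolynomial (Fin 3) ℂ) := by
      rw [← dotProduct_lin_symM G]
      exact congrArg (X ⬝ᵥ ·) (funext fun i => (lin_eq_mulVec A i).symm)
    have hsymm : ∀ y : Fin 3 → MvPolynomial (Fin 3) ℂ, X ⬝ᵥ (Ap *ᵥ y) = y ⬝ᵥ (Ap *ᵥ X) := by
      intro y
      rw [dotProduct_mulVec, ← mulVec_transpose, hApt, dotProduct_comm]
    have h1 : 2 * (f ⬝ᵥ (Ap *ᵥ X)) = G * Q := by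
      rw [← hQ, dotProduct, Finset.mul_sum]
      refine Finset.sum_congr rfl fun i _ => ?_
      rw [pderiv_eq_lin, ← lin_eq_mulVec]
      ring
    obtain ⟨q, hq⟩ : ∃ q, q = C (2⁻¹ : ℂ) * Q := ⟨_, rfl⟩
    have h2 : (C (2⁻¹ : ℂ) : MvPolynomial (Fin 3) ℂ) * 2 = 1 := by
      rw [show (2 : MvPolynomial (Fin 3) ℂ) = C 2 from (map_ofNat C 2).symm, ← map_mul]
      norm_num
    have h3 : X ⬝ᵥ (Ap *ᵥ (f - q • X)) = 0 := by
      rw [hsymm, sub_dotProduct, smul_dotProduct, hGX, hq, smul_eq_mul]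
      linear_combination C (2⁻¹ : ℂ) * h1 - f ⬝ᵥ (Ap *ᵥ X) * h2
    obtain ⟨K, hK⟩ := exists_eq_cross_of_dot_eq_zero h3
    have h4 : Ap.det • (f - q • X) = Ap.adjugate *ᵥ (X ⨯₃ K) := by
      rw [← hK, mulVec_mulVec, adjugate_mul, smul_mulVec, one_mulVec]
    have hdet : Ap.det = C A.det := (RingHom.map_det C A).symm
    have hadj : Ap.adjugate = A.adjugate.map C := (RingHom.map_adjugate C A).symm
    let K' : Fin 3 → SForm 1 d := fun i => ⟨projSForm 1 d (K i), projSForm_mem 1 d _⟩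
    have hcomp : ∀ j, homogeneousComponent d ((X ⨯₃ K) j) =
        (X ⨯₃ fun i => (K' i : MvPolynomial (Fin 3) ℂ)) j := by
      have h5 : ∀ i j, homogeneousComponent d (X i * K j) = X i * (K' j).1 := fun i j => by
        rw [mul_comm, homogeneousComponent_mul_eq_projSForm _ (isHomogeneous_X ℂ i), mul_comm]
      intro j
      fin_cases j <;> simp [cross_apply, h5]
    have h6 : A.det • (radial d).mkQ F = (radial d).mkQ (fieldB d A.adjugate K') := by
      rw [← map_smul, ← sub_eq_zero, ← map_sub, mkQ_radial_eq_zero]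
      refine ⟨C A.det * projSForm 1 d q, fun i => ?_⟩
      have h7 := congrArg (homogeneousComponent d) (congrFun h4 i)
      rw [hdet, hadj] at h7
      simp only [Pi.smul_apply, Pi.sub_apply, smul_eq_mul, homogeneousComponent_C_mul, map_sub,
        mulVec, dotProduct, map_apply, map_sum, hcomp] at h7
      rw [homogeneousComponent_mul_eq_projSForm _ (isHomogeneous_X ℂ i), hf,
        homogeneousComponent_eq_self (F i).2] at h7
      rw [Pi.sub_apply, Pi.smul_apply, Submodule.coe_sub, Submodule.coe_smul, smul_eq_C_mul,
        coe_fieldB]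
      linear_combination h7
    refine ⟨(A.det⁻¹ • fun i => ∑ j, A i j • K' j, 0), ?_⟩
    rw [conicMap_apply, map_zero, map_zero, add_zero, map_smul, map_smul, ← fieldB_adjugate hAt,
      ← h6, smul_smul, inv_mul_cancel₀ hG, one_smul]

/-- The expected dimension is an upper bound for smooth conics, since the multiples of `Az` lie in
the kernel of `H ↦ Az × H`. -/
theorem finrank_invariantFields_le {d : ℕ} {G : TForm 2} (hG : (symM G).det ≠ 0) :
    Module.finrank ℂ (invariantFields d G) ≤ fieldRank d := by
  rw [← range_conicMap_eq_invariantFields hG 0]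
  have h1 : LinearMap.range (conicMap d (symM G) ((0 : ℂ) • (symM G).adjugate)) =
      LinearMap.range ((radial d).mkQ ∘ₗ fieldA d (symM G)) := by
    rw [zero_smul]
    apply le_antisymm
    · rintro _ ⟨⟨H, K⟩, rfl⟩
      exact ⟨H, by simp [conicMap_apply]⟩
    · rintro _ ⟨H, rfl⟩
      exact ⟨(H, 0), by simp [conicMap_apply]⟩
  rw [h1]
  refine finrank_range_le_fieldRank _ (w := symM G) ?_ fun L => ?_
  · intro h
    have h0 : symM G = 0 := h
    exact hG (by rw [h0, det_zero])
  · have : fieldA d (symM G) (mulLin d (symM G) L) = 0 := by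
      ext1 i
      ext1
      fin_cases i <;> simp [coe_fieldA, cross_apply, mulLin] <;> ring
    rw [LinearMap.comp_apply, this, map_zero]

/-! ### Bihomogeneous polynomial functions -/

section Biforms

variable {W W₁ W₂ V : Type*} [AddCommGroup W] [Module ℂ W] [AddCommGroup W₁] [Module ℂ W₁]
  [AddCommGroup W₂] [Module ℂ W₂] [AddCommGroup V] [Module ℂ V]

theorem linear_mem_polyFun (φ : W →ₗ[ℂ] ℂ) : (fun w => φ w) ∈ polyFun W :=
  Algebra.subset_adjoin ⟨φ, rfl⟩

theorem mul_mem_polyFun {f g : W → ℂ} (hf : f ∈ polyFun W) (hg : g ∈ polyFun W) :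
    (fun w => f w * g w) ∈ polyFun W :=
  (polyFun W).mul_mem hf hg

theorem sum_mem_polyFun {ι : Type*} (s : Finset ι) {f : ι → W → ℂ} (hf : ∀ i ∈ s, f i ∈ polyFun W) :
    (fun w => ∑ i ∈ s, f i w) ∈ polyFun W := by
  have := (polyFun W).sum_mem hf
  convert this using 1
  ext w
  simp

theorem prod_mem_polyFun {ι : Type*} (s : Finset ι) {f : ι → W → ℂ}
    (hf : ∀ i ∈ s, f i ∈ polyFun W) : (fun w => ∏ i ∈ s, f i w) ∈ polyFun W := by
  have := (polyFun W).prod_mem hf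
  convert this using 1
  ext w
  simp

theorem const_mul_mem_polyFun (c : ℂ) {f : W → ℂ} (hf : f ∈ polyFun W) :
    (fun w => c * f w) ∈ polyFun W :=
  (polyFun W).smul_mem hf c

theorem det_mem_polyFun {ι : Type*} [Fintype ι] [DecidableEq ι] {M : W → Matrix ι ι ℂ}
    (hM : ∀ i j, (fun w => M w i j) ∈ polyFun W) : (fun w => (M w).det) ∈ polyFun W := by
  simp only [det_apply']
  exact sum_mem_polyFun _ fun σ _ =>
    const_mul_mem_polyFun _ (prod_mem_polyFun _ fun i _ => hM (σ i) i)

theorem adjugate_mem_polyFun {M : W → Matrix (Fin 3) (Fin 3) ℂ}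
    (hM : ∀ i j, (fun w => M w i j) ∈ polyFun W) (i j : Fin 3) :
    (fun w => (M w).adjugate i j) ∈ polyFun W := by
  have h : ∀ w, (M w).adjugate i j = ((M w).updateRow j (Pi.single i 1)).det := fun w =>
    adjugate_apply _ _ _
  simp only [h]
  refine det_mem_polyFun fun k l => ?_
  by_cases hk : k = j
  · subst hk
    simp only [updateRow_self]
    exact (polyFun W).algebraMap_mem ((Pi.single i 1 : Fin 3 → ℂ) l)
  · simp only [updateRow_ne hk]
    exact hM k l

/-- Composition of a polynomial function with a polynomial map. -/
theorem comp_mem_polyFun {f : V → ℂ} (hf : f ∈ polyFun V) {P : W → V}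
    (hP : ∀ φ : Module.Dual ℂ V, (fun w => φ (P w)) ∈ polyFun W) :
    (fun w => f (P w)) ∈ polyFun W := by
  induction hf using Algebra.adjoin_induction with
  | mem x hx =>
    obtain ⟨φ, rfl⟩ := hx
    exact hP φ
  | algebraMap r => exact (polyFun W).algebraMap_mem r
  | add x y hx hy h1 h2 => exact (polyFun W).add_mem h1 h2
  | mul x y hx hy h1 h2 => exact (polyFun W).mul_mem h1 h2

theorem isBiform_det {ι : Type*} [Fintype ι] [DecidableEq ι] {m k : ℕ}
    {M : W₁ × W₂ → Matrix ι ι ℂ} (hM : ∀ i j, IsBiform m k fun w => M w i j) :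
    IsBiform (Fintype.card ι * m) (Fintype.card ι * k) fun w => (M w).det := by
  intro s t w₁ w₂
  have h : M (s • w₁, t • w₂) = (s ^ m * t ^ k) • M (w₁, w₂) := by
    ext i j
    exact hM i j s t w₁ w₂
  simp only [h, det_smul, smul_eq_mul]
  ring

/-- The zero locus of a bihomogeneous polynomial is closed. -/
theorem isBiZariskiClosed_zero {m k : ℕ} {f : W₁ × W₂ → ℂ} (hf : f ∈ polyFun (W₁ × W₂))
    (h : IsBiform m k f) : IsBiZariskiClosed {x : ℙ ℂ W₁ × ℙ ℂ W₂ | f (coords x) = 0} :=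
  ⟨{f}, by rintro _ rfl; exact ⟨hf, m, k, h⟩, by simp⟩

/-- A vector valued bihomogeneous polynomial map `P` stays one after composition with a homogeneous
polynomial. -/
theorem IsBiform.comp {m k n : ℕ} {P : W₁ × W₂ → V} (hP : IsBiform m k P) {f : V → ℂ}
    (hf : IsForm n f) : IsBiform (m * n) (k * n) fun w => f (P w) := by
  intro s t w₁ w₂
  show f (P (s • w₁, t • w₂)) = _
  rw [hP, hf, smul_eq_mul, mul_pow, pow_mul, pow_mul]

end Biforms

/-! ### Equations of the variety of complete conics -/

/-- The square matrix with given entries. -/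
def pairM : (Fin 3 × Fin 3 → ℂ) →ₗ[ℂ] Matrix (Fin 3) (Fin 3) ℂ :=
  LinearMap.pi fun i => LinearMap.pi fun j => LinearMap.proj (i, j)

theorem pairM_apply (w : Fin 3 × Fin 3 → ℂ) (i j : Fin 3) : pairM w i j = w (i, j) := rfl

/-- The entries of the adjugate matrix of a quadratic form, as a vector. -/
noncomputable def adjVec (G : TForm 2) : Fin 3 × Fin 3 → ℂ := fun ij => (symM G).adjugate ij.1 ij.2

theorem pairM_adjVec (G : TForm 2) : pairM (adjVec G) = (symM G).adjugate := rfl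

theorem veroneseMinors_form (G : TForm 2) :
    (fun ij => (veroneseMinors.form ij).1 G) = adjVec G := by
  funext ⟨i, j⟩
  let ev : polyFun (TForm 2) →+* ℂ :=
    (Pi.evalRingHom (fun _ : TForm 2 => ℂ) G).comp (polyFun (TForm 2)).val.toRingHom
  show ev (univMatrix.adjugate i j) = (symM G).adjugate i j
  have h : ev.mapMatrix univMatrix = symM G := rfl
  rw [← h, ← RingHom.map_adjugate]
  rfl

/-- A symmetric matrix of rank at most one is of the form `l lᵗ`. -/
theorem exists_eq_vecMulVec {A : Matrix (Fin 3) (Fin 3) ℂ} (hA : ∀ i j, A i j = A j i)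
    (h : A.adjugate = 0) : ∃ l, A = vecMulVec l l := by
  have hr := symm_rank_one (fun i j => A i j) hA
    (fun i j => by rw [show Matrix.of (fun i j => A i j) = A from rfl, h]; rfl)
  by_cases hd : ∀ i, A i i = 0
  · refine ⟨0, ?_⟩
    ext i j
    have h1 := hr i j i j
    rw [hd i, zero_mul] at h1
    simpa using h1
  · push Not at hd
    obtain ⟨i, hi⟩ := hd
    obtain ⟨s, hs⟩ := IsAlgClosed.exists_pow_nat_eq (A i i) (n := 2) two_pos
    refine ⟨fun j => A i j / s, ?_⟩
    ext j k
    have h1 := hr i i j k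
    rw [vecMulVec_apply, div_mul_div_comm, ← pow_two, hs, eq_div_iff hi, ← h1, mul_comm]

theorem adjugate_vecMulVec (l : Fin 3 → ℂ) : (vecMulVec l l).adjugate = 0 := by
  rw [adjugate_fin_three]
  ext i j
  fin_cases i <;> fin_cases j <;> simp [vecMulVec_apply] <;> ring

theorem mem_veronese_of_adjugate_eq_zero {p : ℙ ℂ (TForm 2)} (h : (symM p.rep).adjugate = 0) :
    p ∈ veronese := by
  obtain ⟨l, hl⟩ := exists_eq_vecMulVec (symM_comm _) h
  refine ⟨lin l, lin_mem l, ?_⟩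
  rw [← dotProduct_lin_symM p.rep, hl]
  have h1 : ∀ i, lin (vecMulVec l l i) = C (l i) * lin l := fun i => lin_smul (l i) l
  simp only [h1, dotProduct, pow_two]
  conv_rhs => rw [lin, Finset.sum_mul]
  exact Finset.sum_congr rfl fun i _ => by rw [lin]; ring

theorem adjugate_eq_zero_of_mem_veronese {p : ℙ ℂ (TForm 2)} (h : p ∈ veronese) :
    (symM p.rep).adjugate = 0 := by
  obtain ⟨l, hl, h⟩ := h
  have h1 : symM p.rep = vecMulVec (fun i => constantCoeff (pderiv i l))
      (fun i => constantCoeff (pderiv i l)) := by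
    ext i j
    exact entryForm_sq i j p.rep l hl h
  rw [h1, adjugate_vecMulVec]

theorem adjVec_smul (c : ℂ) (G : TForm 2) : adjVec (c • G) = c ^ 2 • adjVec G := by
  funext ij
  rw [adjVec, map_smul, adjugate_smul]
  rfl

/-- The pair formed by a conic that is not a double line and its dual conic is a complete conic. -/
theorem mem_completeConics_of_adjVec {x : ℙ ℂ (TForm 2) × ℙ ℂ (Fin 3 × Fin 3 → ℂ)}
    (h0 : adjVec x.1.rep ≠ 0) (h : adjVec x.1.rep ∈ x.2.submodule) : x ∈ completeConics := by
  refine Set.mem_sInter.2 fun Z hZ => hZ.2 ⟨fun hv => h0 ?_, ?_⟩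
  · have := adjugate_eq_zero_of_mem_veronese hv
    funext ij
    exact congrFun (congrFun this ij.1) ij.2
  · rw [veroneseMinors_form]
    exact h

/-- Polynomial functions are continuous along the curve `G + ε Q, adj(G + ε Q)`. -/
theorem continuous_along_curve {f : TForm 2 × (Fin 3 × Fin 3 → ℂ) → ℂ}
    (hf : f ∈ polyFun (TForm 2 × (Fin 3 × Fin 3 → ℂ))) (G Q : TForm 2) :
    Continuous fun ε : ℂ => f (G + ε • Q, adjVec (G + ε • Q)) := by
  induction hf using Algebra.adjoin_induction with
  | mem x hx =>
    obtain ⟨φ, rfl⟩ := hx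
    have hadj : Continuous fun ε : ℂ => (symM (G + ε • Q)).adjugate := by
      refine Continuous.matrix_adjugate ?_
      simp only [map_add, map_smul]
      fun_prop
    have h : ∀ ε : ℂ, φ (G + ε • Q, adjVec (G + ε • Q)) = φ (G, 0) + ε * φ (Q, 0) +
        ∑ ij : Fin 3 × Fin 3, (symM (G + ε • Q)).adjugate ij.1 ij.2 *
          φ (0, Pi.single ij 1) := by
      intro ε
      have h1 : (G + ε • Q, adjVec (G + ε • Q)) = ((G, 0) + ε • (Q, 0) +
          ∑ ij : Fin 3 × Fin 3, (symM (G + ε • Q)).adjugate ij.1 ij.2 •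
            ((0, Pi.single ij 1) : TForm 2 × (Fin 3 × Fin 3 → ℂ))) := by
        refine Prod.ext ?_ ?_
        · simp [Prod.fst_sum]
        · funext kl
          simp [Prod.snd_sum, adjVec, Finset.sum_apply, Pi.single_apply]
      rw [h1]
      simp only [map_add, map_smul, map_sum, smul_eq_mul]
    simp only [h]
    refine Continuous.add (by fun_prop) (continuous_finsetSum _ fun ij _ => ?_)
    exact Continuous.mul (hadj.matrix_elem _ _) continuous_const
  | algebraMap r => exact continuous_const
  | add x y hx hy h1 h2 => exact h1.add h2
  | mul x y hx hy h1 h2 => exact h1.mul h2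

/-- The sum of the squares of the coordinates. -/
noncomputable def unitForm : TForm 2 :=
  ⟨∑ i, X i ^ 2, sum_mem fun i _ => isHomogeneous_X_pow i 2⟩

theorem symM_unitForm : symM unitForm = 1 := by
  ext i j
  rw [symM_apply, entryForm_apply]
  have h2 : constantCoeff (2 : MvPolynomial (Fin 3) ℂ) = 2 := map_ofNat _ 2
  fin_cases i <;> fin_cases j <;>
    simp [unitForm, Fin.sum_univ_three, pderiv_X, Derivation.leibniz_pow, h2]

/-- The pairs formed by a smooth conic and its dual are dense in the variety of complete conics:
a bihomogeneous polynomial that vanishes at these pairs vanishes at all complete conics. -/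
theorem eq_zero_of_forall_smooth {m k : ℕ} {f : TForm 2 × (Fin 3 × Fin 3 → ℂ) → ℂ}
    (hf : f ∈ polyFun (TForm 2 × (Fin 3 × Fin 3 → ℂ))) (hmk : IsBiform m k f)
    (h : ∀ G, (symM G).det ≠ 0 → f (G, adjVec G) = 0)
    {b : ℙ ℂ (TForm 2) × ℙ ℂ (Fin 3 × Fin 3 → ℂ)} (hb : b ∈ completeConics) :
    f (coords b) = 0 := by
  have hall : ∀ G, f (G, adjVec G) = 0 := by
    intro G
    -- `G + ε (z₀² + z₁² + z₂²)` is smooth unless `-ε` is an eigenvalue of the matrix of `G`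
    have hev : ∀ᶠ ε in nhdsWithin (0 : ℂ) {0}ᶜ,
        f (G + ε • unitForm, adjVec (G + ε • unitForm)) = 0 := by
      have hfin : {ε : ℂ | (-symM G).charpoly.IsRoot ε}.Finite :=
        Polynomial.finite_setOfPred_isRoot (charpoly_monic _).ne_zero
      have hopen : ∀ᶠ ε in nhdsWithin (0 : ℂ) {0}ᶜ, ¬ (-symM G).charpoly.IsRoot ε := by
        have h1 : ({ε : ℂ | (-symM G).charpoly.IsRoot ε} \ {0})ᶜ ∈ nhds (0 : ℂ) :=
          (hfin.subset Set.sdiff_subset).isClosed.isOpen_compl.mem_nhds (by simp)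
        filter_upwards [mem_nhdsWithin_of_mem_nhds h1, self_mem_nhdsWithin] with ε h2 h3 h4
        exact h2 ⟨h4, h3⟩
      filter_upwards [hopen] with ε hε
      refine h _ fun h0 => hε ?_
      rw [Polynomial.IsRoot.def, eval_charpoly, ← h0, map_add, map_smul, symM_unitForm,
        sub_neg_eq_add, scalar_apply, ← smul_one_eq_diagonal, add_comm]
    have h1 := (continuous_along_curve hf G unitForm).continuousAt (x := 0)
    have h2 := h1.tendsto.mono_left (nhdsWithin_le_nhds (s := {0}ᶜ))
    simp only [zero_smul, add_zero] at h2
    exact tendsto_nhds_unique (h2.congr' hev) tendsto_const_nhds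
  refine Set.mem_sInter.1 hb _ ⟨isBiZariskiClosed_zero hf hmk, ?_⟩
  rintro ⟨p, q⟩ ⟨hp, hq⟩
  simp only at hp hq
  rw [veroneseMinors_form, Projectivization.submodule_eq, Submodule.mem_span_singleton] at hq
  obtain ⟨c, hc⟩ := hq
  have hc0 : c ≠ 0 := by
    rintro rfl
    rw [zero_smul] at hc
    refine hp (mem_veronese_of_adjugate_eq_zero ?_)
    rw [← pairM_adjVec, ← hc, map_zero]
  have h1 := hmk 1 c p.rep q.rep
  rw [one_smul, hc, hall, one_pow, one_mul, smul_eq_mul] at h1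
  exact (mul_eq_zero.1 h1.symm).resolve_left (pow_ne_zero _ hc0)

section Equations

variable {b : ℙ ℂ (TForm 2) × ℙ ℂ (Fin 3 × Fin 3 → ℂ)}

theorem symM_mem_polyFun (i j : Fin 3) :
    (fun w : TForm 2 × (Fin 3 × Fin 3 → ℂ) => symM w.1 i j) ∈ polyFun _ := by
  have h := linear_mem_polyFun
    ((entryForm i j).comp (LinearMap.fst ℂ (TForm 2) (Fin 3 × Fin 3 → ℂ)))
  exact h

theorem pairM_mem_polyFun (i j : Fin 3) :
    (fun w : TForm 2 × (Fin 3 × Fin 3 → ℂ) => pairM w.2 i j) ∈ polyFun _ := by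
  have h := linear_mem_polyFun
    ((LinearMap.proj (R := ℂ) (φ := fun _ : Fin 3 × Fin 3 => ℂ) (i, j)).comp
      (LinearMap.snd ℂ (TForm 2) (Fin 3 × Fin 3 → ℂ)))
  exact h

theorem pairM_comm (hb : b ∈ completeConics) (i j : Fin 3) :
    pairM b.2.rep i j = pairM b.2.rep j i := by
  rw [← sub_eq_zero]
  refine eq_zero_of_forall_smooth (m := 0) (k := 1) (f := fun w => pairM w.2 i j - pairM w.2 j i)
    ((polyFun _).sub_mem (pairM_mem_polyFun i j) (pairM_mem_polyFun j i)) ?_ ?_ hb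
  · intro s t w₁ w₂
    simp [pairM_apply]
    ring
  · intro G _
    simp only [pairM_adjVec]
    have h := adjugate_transpose (symM G)
    rw [symM_transpose] at h
    have h1 := congrFun (congrFun h j) i
    rw [transpose_apply] at h1
    rw [h1, sub_self]

/-- The matrices `A` and `B` of a complete conic satisfy `AB = t I`. -/
theorem symM_mul_pairM (hb : b ∈ completeConics) :
    symM b.1.rep * pairM b.2.rep = (symM b.1.rep * pairM b.2.rep) 0 0 • 1 := by
  ext i j
  rw [Matrix.smul_apply, smul_eq_mul, ← sub_eq_zero]
  have hmem : ∀ i j, (fun w : TForm 2 × (Fin 3 × Fin 3 → ℂ) => (symM w.1 * pairM w.2) i j) ∈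
      polyFun _ := fun i j => by
    simp only [mul_apply]
    exact sum_mem_polyFun _ fun k _ => mul_mem_polyFun (symM_mem_polyFun i k) (pairM_mem_polyFun k j)
  refine eq_zero_of_forall_smooth (m := 1) (k := 1)
    (f := fun w => (symM w.1 * pairM w.2) i j -
      (symM w.1 * pairM w.2) 0 0 * (1 : Matrix (Fin 3) (Fin 3) ℂ) i j)
    ((polyFun _).sub_mem (hmem i j) (mul_mem_polyFun (hmem 0 0)
      ((polyFun _).algebraMap_mem ((1 : Matrix (Fin 3) (Fin 3) ℂ) i j)))) ?_ ?_ hb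
  · intro s t w₁ w₂
    simp only [map_smul, Matrix.smul_mul, Matrix.mul_smul, Matrix.smul_apply, smul_eq_mul, pow_one]
    ring
  · intro G _
    simp only [pairM_adjVec, mul_adjugate]
    simp

/-- The matrix `B` of a complete conic is parallel to the adjugate matrix of `A`. -/
theorem adjugate_symM_mul_pairM (hb : b ∈ completeConics) (i j k l : Fin 3) :
    (symM b.1.rep).adjugate i j * pairM b.2.rep k l =
      (symM b.1.rep).adjugate k l * pairM b.2.rep i j := by
  rw [← sub_eq_zero]
  have hadj := adjugate_mem_polyFun symM_mem_polyFun
  refine eq_zero_of_forall_smooth (m := 2) (k := 1)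
    (f := fun w => (symM w.1).adjugate i j * pairM w.2 k l -
      (symM w.1).adjugate k l * pairM w.2 i j)
    ((polyFun _).sub_mem (mul_mem_polyFun (hadj i j) (pairM_mem_polyFun k l))
      (mul_mem_polyFun (hadj k l) (pairM_mem_polyFun i j))) ?_ ?_ hb
  · intro s t w₁ w₂
    simp only [map_smul, adjugate_smul, Matrix.smul_apply, smul_eq_mul, pow_one, Fintype.card_fin]
    ring
  · intro G _
    simp only [pairM_adjVec]
    ring

theorem pairM_rep_ne_zero : pairM b.2.rep ≠ 0 := by
  intro h
  refine b.2.rep_nonzero (funext fun ij => ?_)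
  exact congrFun (congrFun h ij.1) ij.2

theorem symM_rep_ne_zero : symM b.1.rep ≠ 0 := fun h =>
  b.1.rep_nonzero (symM_injective (h.trans (map_zero _).symm))

/-- Over a smooth conic the matrix `B` is a multiple of the adjugate matrix of `A`. -/
theorem exists_pairM_eq_smul_adjugate (hb : b ∈ completeConics) (h : (symM b.1.rep).det ≠ 0) :
    ∃ c : ℂ, pairM b.2.rep = c • (symM b.1.rep).adjugate := by
  have hne : (symM b.1.rep).adjugate ≠ 0 := by
    intro h0
    have h1 := mul_adjugate (symM b.1.rep)
    rw [h0, mul_zero] at h1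
    have := congrFun (congrFun h1 0) 0
    simp at this
    exact h this.symm
  obtain ⟨i, j, hij⟩ : ∃ i j, (symM b.1.rep).adjugate i j ≠ 0 := by
    by_contra! h0
    exact hne (Matrix.ext h0)
  refine ⟨pairM b.2.rep i j / (symM b.1.rep).adjugate i j, ?_⟩
  ext k l
  have := adjugate_symM_mul_pairM hb i j k l
  rw [Matrix.smul_apply, smul_eq_mul, div_mul_eq_mul_div, eq_div_iff hij]
  linear_combination this

/-- The space of fields attached to a complete conic. -/
noncomputable def completeFields (d : ℕ) (b : ℙ ℂ (TForm 2) × ℙ ℂ (Fin 3 × Fin 3 → ℂ)) :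
    Submodule ℂ (VField d) :=
  LinearMap.range (conicMap d (symM b.1.rep) (pairM b.2.rep))

theorem completeFields_eq_invariantFields (d : ℕ) (hb : b ∈ completeConics)
    (h : SmoothConic b.1.rep) : completeFields d b = invariantFields d b.1.rep := by
  rw [smoothConic_iff] at h
  obtain ⟨c, hc⟩ := exists_pairM_eq_smul_adjugate hb h
  rw [completeFields, hc, range_conicMap_eq_invariantFields h]

theorem fieldRank_le_finrank_completeFields (d : ℕ) (hb : b ∈ completeConics) :
    fieldRank d ≤ Module.finrank ℂ (completeFields d b) := by
  by_cases hA : (symM b.1.rep).adjugate = 0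
  · have hdet : (symM b.1.rep).det = 0 := by
      have h1 := mul_adjugate (symM b.1.rep)
      rw [hA, mul_zero] at h1
      simpa using congrFun (congrFun h1.symm 0) 0
    have hAB : symM b.1.rep * pairM b.2.rep = 0 := by
      have h1 := symM_mul_pairM hb
      have h2 := congrArg det h1
      rw [det_mul, hdet, zero_mul, det_smul, det_one, mul_one] at h2
      rw [h1, pow_eq_zero_iff (by simp) |>.1 h2.symm, zero_smul]
    by_cases hB : (pairM b.2.rep).adjugate = 0
    · obtain ⟨l, hl⟩ := exists_eq_vecMulVec (symM_comm _) hA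
      obtain ⟨v, hv⟩ := exists_eq_vecMulVec (pairM_comm hb) hB
      have hl0 : l ≠ 0 := by
        rintro rfl
        exact symM_rep_ne_zero (hl.trans (by simp))
      have hv0 : v ≠ 0 := by
        rintro rfl
        exact pairM_rep_ne_zero (hv.trans (by simp))
      rw [completeFields, hl, hv]
      refine fieldRank_le_of_rank_one d hl0 hv0 ?_
      rw [hl, hv, vecMulVec_mul_vecMulVec] at hAB
      obtain ⟨i, hi⟩ := Function.ne_iff.1 hl0
      obtain ⟨j, hj⟩ := Function.ne_iff.1 hv0
      rw [Pi.zero_apply] at hi hj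
      have := congrFun (congrFun hAB i) j
      simpa [vecMulVec_apply, hi, hj] using this
    · exact fieldRank_le_of_adjugate_right_ne_zero d symM_rep_ne_zero hAB hB
  · refine fieldRank_le_of_adjugate_left_ne_zero d _ ?_ hA
    rw [dotProduct_lin_symM]
    exact fun h => b.1.rep_nonzero (Subtype.ext h)

end Equations

/-! ### Elimination theory -/

section Elimination

variable {ι κ : Type*} [Fintype ι] [Fintype κ]

/-- The exponents of the monomials of bidegree `(n, n)` in two groups of variables. -/
def biExponents (ι κ : Type*) [Fintype ι] [Fintype κ] (n : ℕ) : Set (ι ⊕ κ →₀ ℕ) :=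
  {m | ∑ i, m (Sum.inl i) = n ∧ ∑ j, m (Sum.inr j) = n}

theorem finite_biExponents (n : ℕ) : (biExponents ι κ n).Finite := by
  classical
  refine (Set.finite_Icc 0 (Finsupp.equivFunOnFinite.symm fun _ : ι ⊕ κ => n)).subset ?_
  rintro m ⟨h1, h2⟩
  refine ⟨zero_le, ?_⟩
  rintro (i | j)
  · exact (Finset.single_le_sum (f := fun i => m (Sum.inl i)) (fun _ _ => Nat.zero_le _)
      (Finset.mem_univ i)).trans h1.le
  · exact (Finset.single_le_sum (f := fun j => m (Sum.inr j)) (fun _ _ => Nat.zero_le _)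
      (Finset.mem_univ j)).trans h2.le

theorem single_add_single_mem_biExponents (n : ℕ) (i : ι) (j : κ) :
    Finsupp.single (Sum.inl i) n + Finsupp.single (Sum.inr j) n ∈ biExponents ι κ n := by
  classical
  constructor <;> simp [Finsupp.single_apply]

noncomputable instance (n : ℕ) : Fintype (biExponents ι κ n) := (finite_biExponents n).fintype

/-- The ideal generated by the products of a variable of the first group and one of the second. -/
noncomputable def crossIdeal (ι κ : Type*) : Ideal (MvPolynomial (ι ⊕ κ) ℂ) :=
  Ideal.span (Set.range fun ij : ι × κ => X (Sum.inl ij.1) * X (Sum.inr ij.2))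

theorem monomial_mem_crossIdeal_pow {n : ℕ} {m : ι ⊕ κ →₀ ℕ} (hm : m ∈ biExponents ι κ n) :
    monomial m (1 : ℂ) ∈ crossIdeal ι κ ^ n := by
  classical
  induction n generalizing m with
  | zero => rw [pow_zero, Ideal.one_eq_top]; exact Submodule.mem_top
  | succ n ih =>
    obtain ⟨h1, h2⟩ := hm
    obtain ⟨i, -, hi⟩ := Finset.exists_ne_zero_of_sum_ne_zero (h1.trans_ne n.succ_ne_zero)
    obtain ⟨j, -, hj⟩ := Finset.exists_ne_zero_of_sum_ne_zero (h2.trans_ne n.succ_ne_zero)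
    set e : ι ⊕ κ →₀ ℕ := Finsupp.single (Sum.inl i) 1 + Finsupp.single (Sum.inr j) 1 with he
    have hle : e ≤ m := by
      rintro (k | k)
      · by_cases hk : i = k
        · subst hk
          simpa [he, Nat.one_le_iff_ne_zero] using hi
        · simp [he, hk]
      · by_cases hk : j = k
        · subst hk
          simpa [he, Nat.one_le_iff_ne_zero] using hj
        · simp [he, hk]
    have hme : m - e + e = m := tsub_add_cancel_of_le hle
    have hmem : m - e ∈ biExponents ι κ n := by
      constructor
      · have : ∑ k, (m - e + e) (Sum.inl k) = n + 1 := by rw [hme, h1]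
        simp only [Finsupp.add_apply, Finset.sum_add_distrib] at this
        simpa [he, Finsupp.single_apply] using this
      · have : ∑ k, (m - e + e) (Sum.inr k) = n + 1 := by rw [hme, h2]
        simp only [Finsupp.add_apply, Finset.sum_add_distrib] at this
        simpa [he, Finsupp.single_apply] using this
    have hprod : monomial m (1 : ℂ) =
        monomial (m - e) 1 * (X (Sum.inl i) * X (Sum.inr j)) := by
      rw [X, X, monomial_mul, monomial_mul, ← he, hme]
      simp
    rw [hprod, pow_succ]
    exact Ideal.mul_mem_mul (ih hmem) (Ideal.subset_span ⟨(i, j), rfl⟩)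

/-- If a polynomial vanishes at all points obtained from `x` by scaling the two groups of
variables, then its component of bidegree `(n, n)` vanishes at `x`. -/
theorem sum_biExponents_eq_zero (p : MvPolynomial (ι ⊕ κ) ℂ) (x : ι → ℂ) (y : κ → ℂ)
    (h : ∀ s t : ℂ, eval (Sum.elim (s • x) (t • y)) p = 0) (n : ℕ) :
    ∑ m : biExponents ι κ n, coeff m p * eval (Sum.elim x y) (monomial m.1 1) = 0 := by
  classical
  let φ : MvPolynomial (ι ⊕ κ) ℂ →ₐ[ℂ] MvPolynomial (Fin 2) ℂ :=
    aeval (Sum.elim (fun i => C (x i) * X 0) fun j => C (y j) * X 1)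
  have hφ : φ p = 0 := by
    refine MvPolynomial.funext fun u => ?_
    rw [map_zero, ← h (u 0) (u 1)]
    have : (eval u).comp (φ : MvPolynomial (ι ⊕ κ) ℂ →+* MvPolynomial (Fin 2) ℂ) =
        eval (Sum.elim (u 0 • x) (u 1 • y)) := by
      refine MvPolynomial.ringHom_ext (fun r => by simp [φ]) ?_
      rintro (i | j) <;> simp [φ, mul_comm]
    exact congrArg (fun f => f p) this
  have hcoeff : ∀ p, coeff (Finsupp.single 0 n + Finsupp.single 1 n) (φ p) =
      ∑ m : biExponents ι κ n, coeff m p * eval (Sum.elim x y) (monomial m.1 1) := by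
    intro p
    induction p using MvPolynomial.induction_on' with
    | add p q hp hq => simp only [map_add, coeff_add, hp, hq, add_mul, Finset.sum_add_distrib]
    | monomial m a =>
      have h1 : φ (monomial m a) = monomial (Finsupp.single 0 (∑ i, m (Sum.inl i)) +
          Finsupp.single 1 (∑ j, m (Sum.inr j))) (a * eval (Sum.elim x y) (monomial m 1)) := by
        rw [aeval_monomial, eval_monomial, Finsupp.prod_fintype _ _ (by simp),
          Finsupp.prod_fintype _ _ (by simp), Fintype.prod_sum_type, Fintype.prod_sum_type]
        simp only [Sum.elim_inl, Sum.elim_inr, mul_pow, Finset.prod_mul_distrib,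
          Finset.prod_pow_eq_pow_sum, one_mul]
        rw [← mul_one (a * _), ← monomial_mul (R := ℂ), ← C_mul_X_pow_eq_monomial,
          ← C_mul_X_pow_eq_monomial]
        simp only [map_mul, map_prod, map_pow, map_one, algebraMap_eq]
        ring
      have h2 : ∀ a b : ℕ, (Finsupp.single 0 a + Finsupp.single 1 b : Fin 2 →₀ ℕ) =
          Finsupp.single 0 n + Finsupp.single 1 n ↔ a = n ∧ b = n := by
        intro a b
        rw [Finsupp.ext_iff, Fin.forall_fin_two]
        simp
      rw [h1, coeff_monomial]
      simp only [h2, coeff_monomial, ite_mul, zero_mul]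
      by_cases hm : ∑ i, m (Sum.inl i) = n ∧ ∑ j, m (Sum.inr j) = n
      · rw [if_pos hm, Finset.sum_eq_single ⟨m, hm⟩]
        · simp
        · intro m' _ hne
          rw [if_neg fun h => hne (Subtype.ext h.symm)]
        · simp
      · rw [if_neg hm, Finset.sum_eq_zero]
        rintro ⟨m', hm'⟩ _
        rw [if_neg]
        rintro rfl
        exact hm hm'
  rw [← hcoeff, hφ, coeff_zero]

variable {W₁ W₂ V : Type*} [AddCommGroup W₁] [Module ℂ W₁]
  [AddCommGroup W₂] [Module ℂ W₂] [AddCommGroup V] [Module ℂ V]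

theorem exists_eval_eq_of_mem_polyFun (b₁ : Module.Basis ι ℂ W₁) (b₂ : Module.Basis κ ℂ W₂)
    {f : W₁ × W₂ → ℂ} (hf : f ∈ polyFun (W₁ × W₂)) :
    ∃ p : MvPolynomial (ι ⊕ κ) ℂ,
      ∀ w, f w = eval (Sum.elim (b₁.equivFun w.1) (b₂.equivFun w.2)) p := by
  induction hf using Algebra.adjoin_induction with
  | mem x hx =>
    obtain ⟨φ, rfl⟩ := hx
    refine ⟨∑ i, C (φ (b₁ i, 0)) * X (Sum.inl i) + ∑ j, C (φ (0, b₂ j)) * X (Sum.inr j),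
      fun w => ?_⟩
    have h : w = ∑ i, b₁.equivFun w.1 i • (b₁ i, (0 : W₂)) +
        ∑ j, b₂.equivFun w.2 j • ((0 : W₁), b₂ j) := by
      refine Prod.ext ?_ ?_
      · simp [Prod.fst_sum, b₁.sum_repr]
      · simp [Prod.snd_sum, b₂.sum_repr]
    conv_lhs => rw [h]
    simp only [map_add, map_sum, map_smul, smul_eq_mul, map_mul, eval_C, eval_X, Sum.elim_inl,
      Sum.elim_inr, mul_comm]
  | algebraMap r => exact ⟨C r, fun w => by simp⟩
  | add x y hx hy h1 h2 =>
    obtain ⟨p, hp⟩ := h1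
    obtain ⟨q, hq⟩ := h2
    exact ⟨p + q, fun w => by simp [hp, hq]⟩
  | mul x y hx hy h1 h2 =>
    obtain ⟨p, hp⟩ := h1
    obtain ⟨q, hq⟩ := h2
    exact ⟨p * q, fun w => by simp [hp, hq]⟩

/-- The fundamental theorem of elimination theory for equations that are bihomogeneous in
`(w₁, w₂)` and linear in `v`. If the system has no nontrivial solution for `v = v₀` then this is so
outside the zero locus of a form that does not vanish at `v₀`: by the Nullstellensatz, all monomials
of some bidegree `(n, n)` are combinations of the equations for `v = v₀`, and the form is the
determinant of the bidegree `(n, n)` part of the same combinations for general `v`. -/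
theorem exists_form_of_no_solution [FiniteDimensional ℂ W₁] [FiniteDimensional ℂ W₂]
    [FiniteDimensional ℂ V] {T : Set (V →ₗ[ℂ] (W₁ × W₂ → ℂ))}
    (hT : ∀ g ∈ T, (∀ v, g v ∈ polyFun (W₁ × W₂)) ∧ ∃ m k, ∀ v, IsBiform m k (g v)) {v₀ : V}
    (hv₀ : ∀ w₁ w₂, w₁ ≠ 0 → w₂ ≠ 0 → ∃ g ∈ T, g v₀ (w₁, w₂) ≠ 0) :
    ∃ D ∈ polyFun V, (∃ n, IsForm n D) ∧ D v₀ ≠ 0 ∧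
      ∀ v w₁ w₂, w₁ ≠ 0 → w₂ ≠ 0 → (∀ g ∈ T, g v (w₁, w₂) = 0) → D v = 0 := by
  classical
  let b₁ := Module.finBasis ℂ W₁
  let b₂ := Module.finBasis ℂ W₂
  let bV := Module.finBasis ℂ V
  let ι := Fin (Module.finrank ℂ W₁)
  let κ := Fin (Module.finrank ℂ W₂)
  -- the equations as polynomials in the coordinates, depending linearly on `v`
  have hP : ∀ (g : T) k, ∃ p : MvPolynomial (ι ⊕ κ) ℂ,
      ∀ w, g.1 (bV k) w = eval (Sum.elim (b₁.equivFun w.1) (b₂.equivFun w.2)) p :=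
    fun g k => exists_eval_eq_of_mem_polyFun b₁ b₂ ((hT g.1 g.2).1 (bV k))
  choose P hP using hP
  let pL : T → V →ₗ[ℂ] MvPolynomial (ι ⊕ κ) ℂ := fun g => ∑ k, (bV.coord k).smulRight (P g k)
  have hpL : ∀ g v w, g.1 v w =
      eval (Sum.elim (b₁.equivFun w.1) (b₂.equivFun w.2)) (pL g v) := by
    intro g v w
    conv_lhs => rw [← bV.sum_repr v]
    simp only [map_sum, map_smul, Finset.sum_apply, Pi.smul_apply, hP, pL, LinearMap.sum_apply,
      LinearMap.smulRight_apply, Module.Basis.coord_apply, smul_eval, smul_eq_mul]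
  set J : Ideal (MvPolynomial (ι ⊕ κ) ℂ) := Ideal.span (Set.range fun g => pL g v₀) with hJ
  have hrad : crossIdeal ι κ ≤ J.radical := by
    rw [crossIdeal, Ideal.span_le]
    rintro _ ⟨⟨i, j⟩, rfl⟩
    rw [SetLike.mem_coe, ← vanishingIdeal_zeroLocus_eq_radical (K := ℂ), mem_vanishingIdeal_iff]
    intro x hx
    by_contra hne
    simp only [map_mul, aeval_X, mul_eq_zero, not_or] at hne
    let w₁ := b₁.equivFun.symm (x ∘ Sum.inl)
    let w₂ := b₂.equivFun.symm (x ∘ Sum.inr)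
    have h1 : w₁ ≠ 0 := by
      intro h0
      rw [LinearEquiv.map_eq_zero_iff] at h0
      exact hne.1 (congrFun h0 i)
    have h2 : w₂ ≠ 0 := by
      intro h0
      rw [LinearEquiv.map_eq_zero_iff] at h0
      exact hne.2 (congrFun h0 j)
    obtain ⟨g, hg, hgne⟩ := hv₀ w₁ w₂ h1 h2
    refine hgne ?_
    have h3 := hx _ (Ideal.subset_span ⟨⟨g, hg⟩, rfl⟩)
    rw [hpL ⟨g, hg⟩]
    simp only [w₁, w₂, LinearEquiv.apply_symm_apply, Sum.elim_comp_inl_inr]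
    rwa [aeval_eq_eval] at h3
  obtain ⟨n, hn⟩ := Ideal.exists_pow_le_of_le_radical_of_fg hrad
    (IsNoetherian.noetherian (crossIdeal ι κ))
  have hmon : ∀ m : biExponents ι κ n, ∃ c : T →₀ MvPolynomial (ι ⊕ κ) ℂ,
      c.sum (fun g a => a • pL g v₀) = monomial m.1 1 := fun m =>
    Finsupp.mem_span_range_iff_exists_finsupp.1 (hn (monomial_mem_crossIdeal_pow m.2))
  choose c hc using hmon
  let Q : biExponents ι κ n → V →ₗ[ℂ] MvPolynomial (ι ⊕ κ) ℂ := fun m =>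
    ∑ g ∈ (c m).support, LinearMap.mulLeft ℂ (c m g) ∘ₗ pL g
  have hQ : ∀ m v, Q m v = ∑ g ∈ (c m).support, c m g * pL g v := fun m v => by
    simp [Q]
  let M : V → Matrix (biExponents ι κ n) (biExponents ι κ n) ℂ := fun v =>
    Matrix.of fun m m' => coeff m'.1 (Q m v)
  refine ⟨fun v => (M v).det, det_mem_polyFun fun m m' => ?_, ⟨Fintype.card (biExponents ι κ n),
    fun s v => ?_⟩, ?_, ?_⟩
  · exact linear_mem_polyFun (lcoeff ℂ m'.1 ∘ₗ Q m)
  · have : M (s • v) = s • M v := by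
      ext m m'
      simp [M]
    simp only [this, det_smul]
  · have : M v₀ = 1 := by
      ext m m'
      have h1 : Q m v₀ = monomial m.1 1 := by
        rw [hQ, ← hc m]
        rfl
      simp only [M, of_apply, h1, coeff_monomial, one_apply, Subtype.ext_iff]
    simp [this]
  · intro v w₁ w₂ h1 h2 hg
    set x := b₁.equivFun w₁ with hx
    set y := b₂.equivFun w₂ with hy
    refine exists_mulVec_eq_zero_iff.1
      ⟨fun m => eval (Sum.elim x y) (monomial m.1 1), ?_, funext fun m => ?_⟩
    · obtain ⟨i, hi⟩ := Function.ne_iff.1 ((LinearEquiv.map_ne_zero_iff b₁.equivFun).2 h1)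
      obtain ⟨j, hj⟩ := Function.ne_iff.1 ((LinearEquiv.map_ne_zero_iff b₂.equivFun).2 h2)
      let m : biExponents ι κ n := ⟨Finsupp.single (Sum.inl i) n + Finsupp.single (Sum.inr j) n,
        single_add_single_mem_biExponents n i j⟩
      refine Function.ne_iff.2 ⟨m, ?_⟩
      have : monomial m.1 (1 : ℂ) = X (Sum.inl i) ^ n * X (Sum.inr j) ^ n := by
        rw [X_pow_eq_monomial, X_pow_eq_monomial, monomial_mul, one_mul]
      simp only [this, map_mul, map_pow, eval_X, Sum.elim_inl, Sum.elim_inr]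
      exact mul_ne_zero (pow_ne_zero _ hi) (pow_ne_zero _ hj)
    · refine sum_biExponents_eq_zero (Q m v) x y (fun s t => ?_) n
      rw [hQ, map_sum]
      refine Finset.sum_eq_zero fun g _ => ?_
      obtain ⟨a, b, hab⟩ := (hT g.1 g.2).2
      have h3 := hpL g v (s • w₁, t • w₂)
      rw [hab v s t w₁ w₂, hg g.1 g.2, smul_zero, map_smul, map_smul] at h3
      rw [map_mul, ← h3, mul_zero]

end Elimination

/-! ### The bundle of fields on the variety of complete conics -/

section Independence

variable {V : Type*} [AddCommGroup V] [Module ℂ V] {ι : Type*} [Fintype ι] [DecidableEq ι]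

theorem exists_det_ne_zero_of_linearIndependent {u : ι → V} (hu : LinearIndependent ℂ u) :
    ∃ ψ : ι → Module.Dual ℂ V, (Matrix.of fun i j => ψ i (u j)).det ≠ 0 := by
  obtain ⟨g, hg⟩ := LinearMap.exists_leftInverse_of_injective (Fintype.linearCombination ℂ u)
    (LinearMap.ker_eq_bot.2 (linearIndependent_iff_injective_fintypeLinearCombination.1 hu))
  refine ⟨fun i => LinearMap.proj i ∘ₗ g, ?_⟩
  have : (Matrix.of fun i j => (LinearMap.proj i ∘ₗ g : Module.Dual ℂ V) (u j)) = 1 := by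
    ext i j
    have h1 : u j = Fintype.linearCombination ℂ u (Pi.single j 1) := by simp
    have h2 := congrArg (fun f => f (Pi.single j 1)) hg
    simp only [LinearMap.comp_apply, LinearMap.id_apply, ← h1] at h2
    simp [h2, one_apply, Pi.single_apply]
  rw [this, det_one]
  exact one_ne_zero

theorem linearIndependent_of_det_ne_zero {u : ι → V} {ψ : ι → Module.Dual ℂ V}
    (h : (Matrix.of fun i j => ψ i (u j)).det ≠ 0) : LinearIndependent ℂ u := by
  rw [Fintype.linearIndependent_iff]
  intro c hc
  by_contra! hne
  obtain ⟨i, hi⟩ := hne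
  refine h (exists_mulVec_eq_zero_iff.1 ⟨c, fun h0 => hi (congrFun h0 i), funext fun k => ?_⟩)
  have := congrArg (ψ k) hc
  simpa [mulVec, dotProduct, mul_comm] using this

theorem exists_dual_eq_one {v : V} (hv : v ≠ 0) : ∃ φ : Module.Dual ℂ V, φ v = 1 := by
  by_contra! h
  refine hv ((Module.forall_dual_apply_eq_zero_iff ℂ v).1 fun φ => ?_)
  by_contra h0
  exact h ((φ v)⁻¹ • φ) (inv_mul_cancel₀ h0)

/-- A minor of size bigger than the dimension vanishes. -/
theorem det_eq_zero_of_finrank_lt {E : Submodule ℂ V} [FiniteDimensional ℂ E] {u : ι → V}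
    (hu : ∀ i, u i ∈ E) (h : Module.finrank ℂ E < Fintype.card ι) (ψ : ι → Module.Dual ℂ V) :
    (Matrix.of fun i j => ψ i (u j)).det = 0 := by
  by_contra h0
  have hli := linearIndependent_of_det_ne_zero h0
  have h1 : LinearIndependent ℂ fun i => (⟨u i, hu i⟩ : E) :=
    LinearIndependent.of_comp E.subtype hli
  exact absurd h1.fintype_card_le_finrank (by omega)

theorem exists_linearIndependent_of_le_finrank_range {U : Type*} [AddCommGroup U] [Module ℂ U]
    [FiniteDimensional ℂ V] {Φ : U →ₗ[ℂ] V} {n : ℕ}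
    (hn : n ≤ Module.finrank ℂ (LinearMap.range Φ)) :
    ∃ h : Fin n → U, LinearIndependent ℂ fun i => Φ (h i) := by
  let e := Module.finBasis ℂ (LinearMap.range Φ)
  have hrange : ∀ i, ∃ h, Φ h = (e (Fin.castLE hn i) : V) := fun i => (e _).2
  choose h hh using hrange
  refine ⟨h, ?_⟩
  simp only [hh]
  exact (e.linearIndependent.comp _ (Fin.castLE_injective hn)).map' _ (Submodule.ker_subtype _)

/-- The maximal minor of `(v, u₁, …, uᵣ)` given by a family of linear forms, as a linear form in
`v`. -/
def consMinor {r : ℕ} (ψ : Fin (r + 1) → Module.Dual ℂ V) (u : Fin r → V) : V →ₗ[ℂ] ℂ :=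
  have hM (v : V) : (Matrix.of fun i j => ψ i ((Fin.cons v u : Fin (r + 1) → V) j)) =
      (Matrix.of fun i j => ψ i ((Fin.cons 0 u : Fin (r + 1) → V) j)).updateCol 0
        fun i => ψ i v := by
    ext i j
    refine Fin.cases ?_ (fun j => ?_) j <;> simp
  { toFun := fun v => (Matrix.of fun i j => ψ i ((Fin.cons v u : Fin (r + 1) → V) j)).det
    map_add' := fun v v' => by
      rw [hM, hM v, hM v', ← det_updateCol_add]
      simp only [map_add]
      rfl
    map_smul' := fun c v => by
      rw [hM, hM v, RingHom.id_apply, smul_eq_mul, ← det_updateCol_smul]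
      simp only [map_smul]
      rfl }

theorem consMinor_apply {r : ℕ} (ψ : Fin (r + 1) → Module.Dual ℂ V) (u : Fin r → V) (v : V) :
    consMinor ψ u v =
      (Matrix.of fun i j => ψ i ((Fin.cons v u : Fin (r + 1) → V) j)).det := rfl

end Independence

/-- The bihomogeneous polynomial map of bidegree `(1, 1)`
`(A, B) ↦ β(B) Az × H + α(A) B (z × K)` for linear forms `α` and `β`. Its values at a complete
conic lie in the fibre of the bundle. -/
noncomputable def fieldBiform (d : ℕ) (α : Module.Dual ℂ (TForm 2))
    (β : Module.Dual ℂ (Fin 3 × Fin 3 → ℂ)) (h : (Fin 3 → SForm 1 d) × (Fin 3 → SForm 1 d))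
    (w : TForm 2 × (Fin 3 × Fin 3 → ℂ)) : VField d :=
  conicMap d (symM w.1) (pairM w.2) (β w.2 • h.1, α w.1 • h.2)

section FieldBiform

variable {d : ℕ} (α : Module.Dual ℂ (TForm 2)) (β : Module.Dual ℂ (Fin 3 × Fin 3 → ℂ))
  (h : (Fin 3 → SForm 1 d) × (Fin 3 → SForm 1 d))

theorem fieldBiform_apply (w : TForm 2 × (Fin 3 × Fin 3 → ℂ)) :
    fieldBiform d α β h w = β w.2 • (radial d).mkQ (fieldA d (symM w.1) h.1) +
      α w.1 • (radial d).mkQ (fieldB d (pairM w.2) h.2) := by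
  rw [fieldBiform, conicMap_apply, map_smul, map_smul, map_smul, map_smul]

theorem fieldBiform_mem_polyFun (φ : Module.Dual ℂ (VField d)) :
    (fun w => φ (fieldBiform d α β h w)) ∈ polyFun (TForm 2 × (Fin 3 × Fin 3 → ℂ)) := by
  simp only [fieldBiform_apply, map_add, map_smul, smul_eq_mul]
  have h1 := linear_mem_polyFun (β ∘ₗ LinearMap.snd ℂ (TForm 2) (Fin 3 × Fin 3 → ℂ))
  have h2 := linear_mem_polyFun (α ∘ₗ LinearMap.fst ℂ (TForm 2) (Fin 3 × Fin 3 → ℂ))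
  have h3 := linear_mem_polyFun (φ ∘ₗ (radial d).mkQ ∘ₗ (fieldA d).flip h.1 ∘ₗ symM ∘ₗ
    LinearMap.fst ℂ (TForm 2) (Fin 3 × Fin 3 → ℂ))
  have h4 := linear_mem_polyFun (φ ∘ₗ (radial d).mkQ ∘ₗ (fieldB d).flip h.2 ∘ₗ pairM ∘ₗ
    LinearMap.snd ℂ (TForm 2) (Fin 3 × Fin 3 → ℂ))
  exact (polyFun _).add_mem (mul_mem_polyFun h1 h3) (mul_mem_polyFun h2 h4)

theorem isBiform_fieldBiform : IsBiform 1 1 (fieldBiform d α β h) := by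
  intro s t w₁ w₂
  rw [fieldBiform_apply, fieldBiform_apply]
  simp only [map_smul, LinearMap.smul_apply, smul_eq_mul, pow_one, smul_add, smul_smul]
  congr 2 <;> ring

theorem isBiform_det_fieldBiform {n : ℕ}
    (h : Fin n → (Fin 3 → SForm 1 d) × (Fin 3 → SForm 1 d))
    (ψ : Fin n → Module.Dual ℂ (VField d)) :
    IsBiform (Fintype.card (Fin n) * 1) (Fintype.card (Fin n) * 1)
      fun w => (Matrix.of fun i j => ψ i (fieldBiform d α β (h j) w)).det :=
  isBiform_det (m := 1) (k := 1) fun i j s t w₁ w₂ => by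
    simp only [of_apply]
    rw [isBiform_fieldBiform, map_smul]

theorem fieldBiform_coords_mem (b : ℙ ℂ (TForm 2) × ℙ ℂ (Fin 3 × Fin 3 → ℂ)) :
    fieldBiform d α β h (coords b) ∈ completeFields d b := ⟨_, rfl⟩

theorem fieldBiform_mem_invariantFields {G : TForm 2} (hG : (symM G).det ≠ 0) :
    fieldBiform d α β h (G, adjVec G) ∈ invariantFields d G := by
  rw [← range_conicMap_eq_invariantFields hG 1, one_smul]
  exact ⟨_, rfl⟩

variable {α β} in
theorem fieldBiform_eq_conicMap {w : TForm 2 × (Fin 3 × Fin 3 → ℂ)} (hα : α w.1 = 1)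
    (hβ : β w.2 = 1) : fieldBiform d α β h w = conicMap d (symM w.1) (pairM w.2) h := by
  rw [fieldBiform, hα, hβ, one_smul, one_smul]

end FieldBiform

section Bundle

variable {b : ℙ ℂ (TForm 2) × ℙ ℂ (Fin 3 × Fin 3 → ℂ)}

theorem exists_duals_eq_one (b : ℙ ℂ (TForm 2) × ℙ ℂ (Fin 3 × Fin 3 → ℂ)) :
    ∃ (α : Module.Dual ℂ (TForm 2)) (β : Module.Dual ℂ (Fin 3 × Fin 3 → ℂ)),
      α (coords b).1 = 1 ∧ β (coords b).2 = 1 := by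
  obtain ⟨α, hα⟩ := exists_dual_eq_one b.1.rep_nonzero
  obtain ⟨β, hβ⟩ := exists_dual_eq_one b.2.rep_nonzero
  exact ⟨α, β, hα, hβ⟩

/-- All fibres have the expected dimension. The upper bound holds at smooth conics and extends to
all complete conics since it is expressed by the vanishing of minors. -/
theorem finrank_completeFields (d : ℕ) (hb : b ∈ completeConics) :
    Module.finrank ℂ (completeFields d b) = fieldRank d := by
  refine le_antisymm ?_ (fieldRank_le_finrank_completeFields d hb)
  by_contra! hlt
  obtain ⟨h, hli⟩ := exists_linearIndependent_of_le_finrank_range (Nat.succ_le_of_lt hlt)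
  obtain ⟨ψ, hψ⟩ := exists_det_ne_zero_of_linearIndependent hli
  obtain ⟨α, β, hα, hβ⟩ := exists_duals_eq_one b
  refine hψ ?_
  have key := eq_zero_of_forall_smooth
    (f := fun w => (Matrix.of fun i j => ψ i (fieldBiform d α β (h j) w)).det)
    (det_mem_polyFun fun i j => fieldBiform_mem_polyFun α β (h j) (ψ i))
    (isBiform_det_fieldBiform α β h ψ)
    (fun G hG => det_eq_zero_of_finrank_lt
      (fun i => fieldBiform_mem_invariantFields α β (h i) hG)
      ((Nat.lt_succ_of_le (finrank_invariantFields_le hG)).trans_eq (Fintype.card_fin _).symm) ψ)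
    hb
  simp only [fieldBiform_eq_conicMap _ hα hβ] at key
  exact key

theorem exists_basis_completeFields (d : ℕ) (hb : b ∈ completeConics) :
    ∃ h : Fin (fieldRank d) → (Fin 3 → SForm 1 d) × (Fin 3 → SForm 1 d),
      LinearIndependent ℂ (fun i => conicMap d (symM b.1.rep) (pairM b.2.rep) (h i)) ∧
      Submodule.span ℂ (Set.range fun i => conicMap d (symM b.1.rep) (pairM b.2.rep) (h i)) =
        completeFields d b := by
  obtain ⟨h, hli⟩ := exists_linearIndependent_of_le_finrank_range (finrank_completeFields d hb).ge
  refine ⟨h, hli, Submodule.eq_of_le_of_finrank_eq ?_ ?_⟩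
  · rw [Submodule.span_le]
    rintro _ ⟨i, rfl⟩
    exact LinearMap.mem_range_self _ _
  · rw [finrank_span_eq_card hli, Fintype.card_fin, finrank_completeFields d hb]

/-- Near a complete conic the sections `β(B) Az × H + α(A) B (z × K)`, divided by `α(A) β(B)`,
for suitable `(H, K)` form a frame of the bundle. -/
theorem isSubbundle_completeFields (d : ℕ) :
    IsSubbundle completeConics (fieldRank d) fun b => completeFields d b.1 := by
  rintro ⟨x₀, hx₀⟩
  obtain ⟨h, hli, -⟩ := exists_basis_completeFields d hx₀
  obtain ⟨ψ, hψ⟩ := exists_det_ne_zero_of_linearIndependent hli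
  obtain ⟨α, β, hα, hβ⟩ := exists_duals_eq_one x₀
  let Q : TForm 2 × (Fin 3 × Fin 3 → ℂ) → ℂ := fun w => α w.1 * β w.2
  have hQ : Q ∈ polyFun _ := mul_mem_polyFun
    (linear_mem_polyFun (α ∘ₗ LinearMap.fst ℂ (TForm 2) (Fin 3 × Fin 3 → ℂ)))
    (linear_mem_polyFun (β ∘ₗ LinearMap.snd ℂ (TForm 2) (Fin 3 × Fin 3 → ℂ)))
  have hQ' : IsBiform 1 1 Q := by
    intro s t w₁ w₂
    simp only [Q, map_smul, smul_eq_mul]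
    ring
  let D : TForm 2 × (Fin 3 × Fin 3 → ℂ) → ℂ :=
    fun w => (Matrix.of fun i j => ψ i (fieldBiform d α β (h j) w)).det
  have hD : D ∈ polyFun _ := det_mem_polyFun fun i j => fieldBiform_mem_polyFun α β (h j) (ψ i)
  have hD' : IsBiform (Fintype.card (Fin (fieldRank d)) * 1)
      (Fintype.card (Fin (fieldRank d)) * 1) D :=
    isBiform_det_fieldBiform α β h ψ
  have hU : IsBiZariskiClosed
      {x : ℙ ℂ (TForm 2) × ℙ ℂ (Fin 3 × Fin 3 → ℂ) | Q (coords x) * D (coords x) ≠ 0}ᶜ := by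
    have hQD : IsBiform (1 + Fintype.card (Fin (fieldRank d)) * 1)
        (1 + Fintype.card (Fin (fieldRank d)) * 1) fun w => Q w * D w := by
      intro s t w₁ w₂
      simp only
      rw [hQ', hD']
      simp only [smul_eq_mul]
      ring
    have := isBiZariskiClosed_zero (mul_mem_polyFun hQ hD) hQD
    convert this using 1
    ext x
    simp only [Set.mem_compl_iff, Set.mem_ofPred_eq, not_not]
  refine ⟨_, hU, ?_, fun i x => (Q (coords x.1))⁻¹ • fieldBiform d α β (h i) (coords x.1), ?_⟩
  · refine mul_ne_zero ?_ ?_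
    · simp [Q, hα, hβ]
    · simp only [D, fieldBiform_eq_conicMap _ hα hβ]
      exact hψ
  · rintro x hx
    have hQx : Q (coords x.1) ≠ 0 := left_ne_zero_of_mul hx
    have hDx : D (coords x.1) ≠ 0 := right_ne_zero_of_mul hx
    have hli : LinearIndependent ℂ
        fun i => (Q (coords x.1))⁻¹ • fieldBiform d α β (h i) (coords x.1) :=
      (linearIndependent_of_det_ne_zero hDx).units_smul fun _ => (Units.mk0 _ hQx)⁻¹
    refine ⟨fun i => ⟨_, hU, hx, 1, 1, fieldBiform d α β (h i), Q,
      fieldBiform_mem_polyFun α β (h i), isBiform_fieldBiform α β (h i), hQ, hQ',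
      fun y hy => ⟨left_ne_zero_of_mul hy, rfl⟩⟩, hli, ?_⟩
    refine Submodule.eq_of_le_of_finrank_eq ?_ ?_
    · rw [Submodule.span_le]
      rintro _ ⟨i, rfl⟩
      exact Submodule.smul_mem _ _ (fieldBiform_coords_mem α β (h i) x.1)
    · rw [finrank_span_eq_card hli, Fintype.card_fin, finrank_completeFields d x.2]

/-! ### The image of the bundle -/

/-- A form that vanishes on the foliations with an invariant smooth conic vanishes on all fibres of
the bundle, by the density of the smooth conics. -/
theorem eq_zero_of_mem_completeFields {d m : ℕ} {f : VField d → ℂ} (hf : f ∈ polyFun (VField d))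
    (hm : IsForm m f) (h0 : ∀ ξ ∈ smoothConicLocus d, f ξ.rep = 0) (hb : b ∈ completeConics)
    {ξ : ℙ ℂ (VField d)} (hξ : ξ.rep ∈ completeFields d b) : f ξ.rep = 0 := by
  obtain ⟨h, hh⟩ := hξ
  obtain ⟨α, β, hα, hβ⟩ := exists_duals_eq_one b
  obtain ⟨φ, hφ⟩ := exists_dual_eq_one ξ.rep_nonzero
  -- the factor `φ` makes the form vanish at the zero field also if `f` is constant
  have hform : IsForm (1 + m) fun v => φ v * f v := by
    intro c v
    simp only [map_smul, smul_eq_mul]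
    rw [hm]
    ring
  have key := eq_zero_of_forall_smooth
    (f := fun w => (fun v => φ v * f v) (fieldBiform d α β h w))
    (comp_mem_polyFun (mul_mem_polyFun (linear_mem_polyFun φ) hf)
      (fieldBiform_mem_polyFun α β h))
    ((isBiform_fieldBiform α β h).comp hform) ?_ hb
  · rw [fieldBiform_eq_conicMap _ hα hβ] at key
    have hh' : conicMap d (symM (coords b).1) (pairM (coords b).2) h = ξ.rep := hh
    rw [hh'] at key
    simpa [hφ] using key
  · intro G hG
    have hv := fieldBiform_mem_invariantFields α β h hG
    by_cases hv0 : fieldBiform d α β h (G, adjVec G) = 0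
    · simp [hv0]
    · obtain ⟨a, ha⟩ := Projectivization.exists_smul_eq_mk_rep ℂ _ hv0
      have h1 := h0 (Projectivization.mk ℂ _ hv0) (mem_smoothConicLocus_iff.2
        ⟨G, (smoothConic_iff G).2 hG, ha ▸ Submodule.smul_mem _ (a : ℂ) hv⟩)
      rw [← ha, Units.smul_def, hm] at h1
      simp [(mul_eq_zero.1 h1).resolve_left (pow_ne_zero _ a.ne_zero)]

/-- Foliations with an invariant smooth conic lie in a fibre of the bundle. -/
theorem exists_completeFields_of_mem_locus {d : ℕ} {ξ : ℙ ℂ (VField d)}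
    (hξ : ξ ∈ smoothConicLocus d) : ∃ b ∈ completeConics, ξ.rep ∈ completeFields d b := by
  obtain ⟨G, hG, h⟩ := mem_smoothConicLocus_iff.1 hξ
  have hdet := (smoothConic_iff G).1 hG
  have hG0 : G ≠ 0 := fun h0 => hG.ne_zero (congrArg Subtype.val h0)
  have hadj : adjVec G ≠ 0 := by
    intro h0
    have h1 := mul_adjugate (symM G)
    rw [← pairM_adjVec, h0, map_zero, mul_zero] at h1
    exact hdet (by simpa using (congrFun (congrFun h1 0) 0).symm)
  obtain ⟨a, ha⟩ := Projectivization.exists_smul_eq_mk_rep ℂ G hG0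
  rw [Units.smul_def] at ha
  have ha2 : (a : ℂ) ^ 2 ≠ 0 := pow_ne_zero _ a.ne_zero
  have hb : (Projectivization.mk ℂ G hG0, Projectivization.mk ℂ (adjVec G) hadj) ∈
      completeConics := by
    refine mem_completeConics_of_adjVec ?_ ?_
    · rw [← ha, adjVec_smul]
      exact smul_ne_zero ha2 hadj
    · rw [← ha, adjVec_smul, Projectivization.submodule_mk]
      exact Submodule.smul_mem _ _ (Submodule.mem_span_singleton_self _)
  have hsm : SmoothConic (Projectivization.mk ℂ G hG0).rep := by
    rw [smoothConic_iff, ← ha, map_smul, det_smul]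
    exact mul_ne_zero (pow_ne_zero _ a.ne_zero) hdet
  refine ⟨_, hb, ?_⟩
  rw [completeFields_eq_invariantFields d hb hsm, ← ha, invariantFields_smul a.ne_zero]
  exact h

theorem IsBiform.ne_zero_of_coords_mk {W₁ W₂ : Type*} [AddCommGroup W₁] [Module ℂ W₁]
    [AddCommGroup W₂] [Module ℂ W₂] {m k : ℕ} {f : W₁ × W₂ → ℂ} (hf : IsBiform m k f)
    {w₁ : W₁} {w₂ : W₂} (h₁ : w₁ ≠ 0) (h₂ : w₂ ≠ 0)
    (h : f (coords (Projectivization.mk ℂ w₁ h₁, Projectivization.mk ℂ w₂ h₂)) ≠ 0) :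
    f (w₁, w₂) ≠ 0 := by
  obtain ⟨a, ha⟩ := Projectivization.exists_smul_eq_mk_rep ℂ w₁ h₁
  obtain ⟨c, hc⟩ := Projectivization.exists_smul_eq_mk_rep ℂ w₂ h₂
  rw [coords, ← ha, ← hc, Units.smul_def, Units.smul_def, hf] at h
  exact right_ne_zero_of_mul h

/-- The minors that express that `v` lies in the fibre of the bundle, as functions that are linear
in `v` and bihomogeneous in the complete conic. The factor in front of `v` makes all columns of
bidegree `(1, 1)`. -/
noncomputable def incidenceMinor (d : ℕ) {r : ℕ} (α : Module.Dual ℂ (TForm 2))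
    (β : Module.Dual ℂ (Fin 3 × Fin 3 → ℂ))
    (h : Fin r → (Fin 3 → SForm 1 d) × (Fin 3 → SForm 1 d))
    (ψ : Fin (r + 1) → Module.Dual ℂ (VField d)) :
    VField d →ₗ[ℂ] (TForm 2 × (Fin 3 × Fin 3 → ℂ) → ℂ) :=
  LinearMap.pi fun w =>
    (α w.1 * β w.2) • consMinor ψ fun j => fieldBiform d α β (h j) w

theorem incidenceMinor_apply {d r : ℕ} (α : Module.Dual ℂ (TForm 2))
    (β : Module.Dual ℂ (Fin 3 × Fin 3 → ℂ))
    (h : Fin r → (Fin 3 → SForm 1 d) × (Fin 3 → SForm 1 d))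
    (ψ : Fin (r + 1) → Module.Dual ℂ (VField d)) (v : VField d)
    (w : TForm 2 × (Fin 3 × Fin 3 → ℂ)) :
    incidenceMinor d α β h ψ v w = (Matrix.of fun i j => ψ i ((Fin.cons ((α w.1 * β w.2) • v)
      fun j => fieldBiform d α β (h j) w : Fin (r + 1) → VField d) j)).det := by
  rw [← consMinor_apply, map_smul]
  rfl

theorem incidenceMinor_mem_polyFun {d r : ℕ} (α : Module.Dual ℂ (TForm 2))
    (β : Module.Dual ℂ (Fin 3 × Fin 3 → ℂ))
    (h : Fin r → (Fin 3 → SForm 1 d) × (Fin 3 → SForm 1 d))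
    (ψ : Fin (r + 1) → Module.Dual ℂ (VField d)) (v : VField d) :
    incidenceMinor d α β h ψ v ∈ polyFun (TForm 2 × (Fin 3 × Fin 3 → ℂ)) := by
  simp only [funext (incidenceMinor_apply α β h ψ v)]
  refine det_mem_polyFun fun i j => ?_
  refine Fin.cases ?_ (fun j => ?_) j
  · simp only [of_apply, Fin.cons_zero, map_smul, smul_eq_mul]
    exact mul_mem_polyFun (mul_mem_polyFun
      (linear_mem_polyFun (α ∘ₗ LinearMap.fst ℂ (TForm 2) (Fin 3 × Fin 3 → ℂ)))
      (linear_mem_polyFun (β ∘ₗ LinearMap.snd ℂ (TForm 2) (Fin 3 × Fin 3 → ℂ))))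
      ((polyFun _).algebraMap_mem (ψ i v))
  · simp only [of_apply, Fin.cons_succ]
    exact fieldBiform_mem_polyFun α β (h j) (ψ i)

theorem isBiform_incidenceMinor {d r : ℕ} (α : Module.Dual ℂ (TForm 2))
    (β : Module.Dual ℂ (Fin 3 × Fin 3 → ℂ))
    (h : Fin r → (Fin 3 → SForm 1 d) × (Fin 3 → SForm 1 d))
    (ψ : Fin (r + 1) → Module.Dual ℂ (VField d)) (v : VField d) :
    IsBiform (Fintype.card (Fin (r + 1)) * 1) (Fintype.card (Fin (r + 1)) * 1)
      (incidenceMinor d α β h ψ v) := by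
  rw [funext (incidenceMinor_apply α β h ψ v)]
  refine isBiform_det (m := 1) (k := 1) fun i j s t w₁ w₂ => ?_
  refine Fin.cases ?_ (fun j => ?_) j
  · simp only [of_apply, Fin.cons_zero, map_smul, smul_eq_mul]
    ring
  · simp only [of_apply, Fin.cons_succ]
    rw [isBiform_fieldBiform, map_smul]

theorem incidenceMinor_eq_zero {d : ℕ} (α : Module.Dual ℂ (TForm 2))
    (β : Module.Dual ℂ (Fin 3 × Fin 3 → ℂ))
    (h : Fin (fieldRank d) → (Fin 3 → SForm 1 d) × (Fin 3 → SForm 1 d))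
    (ψ : Fin (fieldRank d + 1) → Module.Dual ℂ (VField d)) {v : VField d}
    (hb : b ∈ completeConics) (hv : v ∈ completeFields d b) :
    incidenceMinor d α β h ψ v (coords b) = 0 := by
  rw [incidenceMinor_apply]
  refine det_eq_zero_of_finrank_lt (E := completeFields d b) (fun i => ?_) ?_ ψ
  · refine Fin.cases ?_ (fun j => ?_) i
    · exact Submodule.smul_mem _ _ hv
    · exact fieldBiform_coords_mem α β (h j) b
  · rw [finrank_completeFields d hb, Fintype.card_fin]
    exact Nat.lt_succ_self _

theorem exists_incidenceMinor_ne_zero {d : ℕ} {v : VField d} (hb : b ∈ completeConics)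
    (hv : v ∉ completeFields d b) :
    ∃ α β, ∃ (h : Fin (fieldRank d) → (Fin 3 → SForm 1 d) × (Fin 3 → SForm 1 d)) (ψ : _),
      incidenceMinor d α β h ψ v (coords b) ≠ 0 := by
  obtain ⟨h, hli, hspan⟩ := exists_basis_completeFields d hb
  rw [← hspan] at hv
  obtain ⟨ψ, hψ⟩ := exists_det_ne_zero_of_linearIndependent
    (linearIndependent_finCons.2 ⟨hli, hv⟩)
  obtain ⟨α, β, hα, hβ⟩ := exists_duals_eq_one b
  refine ⟨α, β, h, ψ, ?_⟩
  rw [incidenceMinor_apply]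
  simp only [fieldBiform_eq_conicMap _ hα hβ]
  rw [hα, hβ, mul_one, one_smul]
  exact hψ

/-- The image of the projective bundle is closed, by elimination theory: a point outside the image
is separated from it by a form. -/
theorem exists_form_of_notMem_completeFields {d : ℕ} {v₀ : VField d} (h0 : v₀ ≠ 0)
    (hv₀ : ∀ b ∈ completeConics, v₀ ∉ completeFields d b) :
    ∃ D ∈ polyFun (VField d), (∃ n, IsForm n D) ∧ D v₀ ≠ 0 ∧
      ∀ b ∈ completeConics, ∀ v ∈ completeFields d b, D v = 0 := by
  -- the equations of the variety of complete conics are made linear in `v` by linear factors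
  let T : Set (VField d →ₗ[ℂ] (TForm 2 × (Fin 3 × Fin 3 → ℂ) → ℂ)) :=
    {g | ∃ (φ : Module.Dual ℂ (VField d)) (f : TForm 2 × (Fin 3 × Fin 3 → ℂ) → ℂ),
      f ∈ polyFun _ ∧ (∃ m k, IsBiform m k f) ∧ (∀ b ∈ completeConics, f (coords b) = 0) ∧
      g = φ.smulRight f} ∪
    {g | ∃ (α : _) (β : _) (h : Fin (fieldRank d) → _) (ψ : _), g = incidenceMinor d α β h ψ}
  have hT : ∀ g ∈ T, (∀ v, g v ∈ polyFun _) ∧ ∃ m k, ∀ v, IsBiform m k (g v) := by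
    rintro g (⟨φ, f, hf, ⟨m, k, hmk⟩, -, rfl⟩ | ⟨α, β, h, ψ, rfl⟩)
    · refine ⟨fun v => (polyFun _).smul_mem hf (φ v), m, k, fun v s t w₁ w₂ => ?_⟩
      simp only [LinearMap.smulRight_apply, Pi.smul_apply]
      rw [hmk, smul_comm]
    · exact ⟨incidenceMinor_mem_polyFun α β h ψ, _, _, isBiform_incidenceMinor α β h ψ⟩
  have hsol : ∀ w₁ w₂, w₁ ≠ 0 → w₂ ≠ 0 → ∃ g ∈ T, g v₀ (w₁, w₂) ≠ 0 := by
    intro w₁ w₂ h1 h2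
    by_cases hx : (Projectivization.mk ℂ w₁ h1, Projectivization.mk ℂ w₂ h2) ∈ completeConics
    · obtain ⟨α, β, h, ψ, hne⟩ := exists_incidenceMinor_ne_zero hx (hv₀ _ hx)
      exact ⟨_, Or.inr ⟨α, β, h, ψ, rfl⟩,
        (isBiform_incidenceMinor α β h ψ v₀).ne_zero_of_coords_mk h1 h2 hne⟩
    · obtain ⟨φ, hφ⟩ := exists_dual_eq_one h0
      have hx' := hx
      simp only [completeConics, blowup, biZariskiClosure, Set.mem_sInter, not_forall] at hx'
      obtain ⟨Z, ⟨⟨S, hS, rfl⟩, hsub⟩, hxZ⟩ := hx'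
      simp only [Set.mem_ofPred_eq, not_forall] at hxZ
      obtain ⟨f, hf, hne⟩ := hxZ
      obtain ⟨hfp, m, k, hmk⟩ := hS f hf
      refine ⟨φ.smulRight f, Or.inl ⟨φ, f, hfp, ⟨m, k, hmk⟩, fun b hb => ?_, rfl⟩, ?_⟩
      · exact Set.mem_sInter.1 hb _ ⟨⟨S, hS, rfl⟩, hsub⟩ f hf
      · simpa [hφ] using hmk.ne_zero_of_coords_mk h1 h2 hne
  obtain ⟨D, hD, hn, hD0, hDv⟩ := exists_form_of_no_solution hT hsol
  refine ⟨D, hD, hn, hD0, fun b hb v hv =>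
    hDv v b.1.rep b.2.rep b.1.rep_nonzero b.2.rep_nonzero ?_⟩
  rintro g (⟨φ, f, -, -, hf, rfl⟩ | ⟨α, β, h, ψ, rfl⟩)
  · have : f (b.1.rep, b.2.rep) = 0 := hf b hb
    simp [this]
  · exact incidenceMinor_eq_zero α β h ψ hb hv

end Bundle

end CompleteConics

theorem mainTheorem3 (d : ℕ) :
    ∃ (r : ℕ) (E : completeConics → Submodule ℂ (VField d)),
      IsSubbundle completeConics r E ∧
      (∀ b : completeConics, SmoothConic b.1.1.rep → E b = invariantFields d b.1.1.rep) ∧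
      Prod.snd '' projBundle completeConics E = zariskiClosure (smoothConicLocus d) := by
  refine ⟨fieldRank d, fun b => completeFields d b.1, isSubbundle_completeFields d,
    fun b hb => completeFields_eq_invariantFields d b.2 hb, ?_⟩
  have hmem : ∀ (ξ : ℙ ℂ (VField d)) (E : Submodule ℂ (VField d)),
      ξ.submodule ≤ E ↔ ξ.rep ∈ E := fun ξ E => by
    rw [Projectivization.submodule_eq, Submodule.span_singleton_le_iff_mem]
  apply Set.Subset.antisymm
  · rintro _ ⟨⟨b, ξ⟩, hξ, rfl⟩
    refine Set.mem_sInter.2 ?_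
    rintro Z ⟨⟨T, hT, rfl⟩, hsub⟩ f hf
    obtain ⟨hfp, m, hm⟩ := hT f hf
    exact eq_zero_of_mem_completeFields hfp hm (fun η hη => hsub hη f hf) b.2 ((hmem _ _).1 hξ)
  · intro ξ hξ
    by_contra hnot
    obtain ⟨D, hD, hn, hD0, hDv⟩ := exists_form_of_notMem_completeFields ξ.rep_nonzero
      (fun b hb hv => hnot ⟨(⟨b, hb⟩, ξ), (hmem _ _).2 hv, rfl⟩)
    refine hD0 (Set.mem_sInter.1 hξ {η | ∀ f ∈ ({D} : Set _), f η.rep = 0}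
      ⟨⟨{D}, by rintro _ rfl; exact ⟨hD, hn⟩, rfl⟩, fun η hη => ?_⟩ D rfl)
    rintro _ rfl
    obtain ⟨b, hb, hv⟩ := exists_completeFields_of_mem_locus hη
    exact hDv b hb _ hv
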